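/- **Theorem (Existence of a unique invariant measure).** *Data.* Let $d,N\ge 1$ and $d_Z\ge 0$ be integers; $\|\cdot\|_{\max}$ is the max norm, and $\mathsf{Wass}_2(\mu,\nu)=\inf_\gamma\big(\int\|\mathsf x-\mathsf y\|_{\max}^2\,\gamma(d\mathsf x,d\mathsf y)\big)^{1/2}$, the infimum being over all couplings $\gamma$ of $\mu,\nu$. Let $\wp$ be a Markov kernel on $\mathbb R^{d+d_Z}$ with $\mathsf{Wass}_2(\wp(u,\cdot),\wp(u',\cdot))\le L_\wp\|u-u'\|_{\max}$ for all $u\ne u'$, where $L_\wp\ge 0$. Call a law $\rho_0$ on $\mathbb R^{d+d_Z}$ admissible if the Markov chain $U_t=(X_t,Z_t)$ with kernel $\wp$ and $U_0\sim\rho_0$ satisfies $\|U_t\|_{\max}\le1$ almost surely for every $t\ge0$; assume that an admissible law exists. Let $\mu_\eta$ be a probability measure on $\mathbb R$ with finite second moment. *Network.* Let $\sigma(y)=1/(1+e^{-y})$ and let $\phi\in C^2(\mathbb R)$ satisfy $|\phi|\le C_\phi$, $|\phi'|\le C_{\phi'}$, $|\phi''|\le C_{\phi''}$, with $C_\phi>0$.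 For $\theta=(A,W,B,c)\in\mathbb R^{N\times d}\times\mathbb R^{N\times N}\times\mathbb R^N\times\mathbb R$ let $$S^k_{t+1}=\sigma(a^k_t),\qquad a^k_t=\tfrac1d\sum_{j}\phi(A^{kj})X^j_t+\tfrac1N\sum_{l}\phi(W^{kl})S^l_t .$$ The first derivatives $\tilde S_t=(\partial S_t/\partial A,\ \partial S_t/\partial W)$ and the second derivatives $\tilde{\tilde S}_t=(\partial^2S_t/\partial A\partial A,\ \partial^2S_t/\partial W\partial A,\ \partial^2S_t/\partial W\partial W)$ evolve by the chain rule. For entries $p,r$ of $A$ or $W$, $$\tilde S^{p,k}_{t+1}=\sigma'(a^k_t)\,D_pa^k_t,\qquad \tilde{\tilde S}^{p,r,k}_{t+1}=\sigma''(a^k_t)\,D_pa^k_t\,D_ra^k_t+\sigma'(a^k_t)\,D_{p,r}a^k_t,$$ where $$D_{A^{ij}}a^k=\tfrac1d\delta_{ik}\phi'(A^{ij})X^j+\tfrac1N\sum_l\phi(W^{kl})\tilde S^{A^{ij},l},\qquad D_{W^{ij}}a^k=\tfrac1N\delta_{ik}\phi'(W^{ij})S^j+\tfrac1N\sum_l\phi(W^{kl})\tilde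 S^{W^{ij},l},$$ $$D_{A^{nm},A^{ij}}a^k=\tfrac1d\delta_{ik}\delta_{ij=nm}\phi''(A^{ij})X^j+\tfrac1N\sum_l\phi(W^{kl})\tilde{\tilde S}^{A^{ij},A^{nm},l},$$ $$D_{W^{nm},A^{ij}}a^k=\tfrac1N\delta_{kn}\phi'(W^{nm})\tilde S^{A^{ij},m}+\tfrac1N\sum_l\phi(W^{kl})\tilde{\tilde S}^{W^{nm},A^{ij},l},$$ $$D_{W^{nm},W^{ij}}a^k=\tfrac1N\delta_{ik}\delta_{ij=nm}\phi''(W^{ij})S^j+\tfrac1N\delta_{ik}\phi'(W^{ij})\tilde S^{W^{nm},j}+\tfrac1N\delta_{kn}\phi'(W^{nm})\tilde S^{W^{ij},m}+\tfrac1N\sum_l\phi(W^{kl})\tilde{\tilde S}^{W^{nm},W^{ij},l}.$$ With $V_t=(S_t,\tilde S_t,\tilde{\tilde S}_t)$ this reads $V_{t+1}=F^\theta(U_t,V_t)$, which is used from arbitrary starting values $V_0$. The joint chain $H_t=(U_t,V_t,\eta_t)$ is the Markov chain with kernel $P_\theta((u,v,\eta),\cdot)=\wp(u,\cdot)\otimes\delta_{F^\theta(u,v)}\otimes\mu_\eta$.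 *Constants.* Let $m=\min(N,d)$, $M_\phi=1+\frac{C_\phi}{4-C_\phi}$, $L=\max(L_0,L_1)$, $$L_0=\max\Big(\tfrac{3C_{\phi'}}{m}\big(\tfrac{C_\phi M_\phi}{10}+\tfrac14\big),\tfrac{3C_\phi}{4}\Big),\qquad L_2=\max\Big(\tfrac{C_{\phi''}}{m},\tfrac{C_{\phi'}^2}{Nd(4-C_\phi)}\Big),$$ $$L_1=\max\Big(4\max\Big[\tfrac{M_\phi C_\phi^2}{5m^2}+\tfrac{C_\phi M_\phi^2C_{\phi'}^2}{8m^2}+\tfrac{C_{\phi''}}{4m}+\tfrac{C_\phi}{10}\Big(L_2+\tfrac{C_\phi}{1-C_\phi/4}\big(\tfrac{C_\phi^2M_\phi^2}{10m^2}+\tfrac14L_2\big)\Big),\ \tfrac{C_\phi M_\phi C_{\phi'}}{5m}+\tfrac{C_{\phi'}}{4N}\Big],\ C_\phi\Big),$$ and assume that $q:=\sqrt{L_\wp^2+L^2}<1$. *Conclusion.* For every $\theta$ the kernel $P_\theta$ has exactly one invariant probability measure $\mu^\theta$ on the whole state space, and $\mu^\theta$ has a finite second moment. Moreover, for every $K\ge0$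 there is a constant $C'>0$ such that, for all $\theta$, all $t\ge0$ and all initial laws $\mu^\theta_0=\rho$ of $H_0=(U_0,V_0,\eta_0)$ for which the law of $U_0$ is admissible, $\|V_0\|_{\max}\le K$ almost surely and $\mathbb E|\eta_0|^2\le K$, the law $\mu^\theta_t$ of $H_t$ satisfies $$\mathsf{Wass}_2(\mu^\theta_t,\mu^\theta)\le C'q^t,$$ and hence $\mathsf{Wass}_2(\mu^\theta_t,\mu^\theta)\to0$ as $t\to\infty$. -/

import Mathlib

open MeasureTheory ProbabilityTheory Filter Topology
open scoped ENNReal NNReal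

noncomputable section

namespace RNN

/-! ### Wasserstein distance -/

/-- `γ` is a coupling of `μ` and `ν`. -/
def IsCoupling {X : Type*} [MeasurableSpace X] (γ : Measure (X × X)) (μ ν : Measure X) : Prop :=
  γ.map Prod.fst = μ ∧ γ.map Prod.snd = ν

/-- The `p`-Wasserstein distance of two measures on a normed space, as an extended
nonnegative real: the infimum over all couplings `γ` of `(∫ ‖x - y‖ ^ p dγ(x, y)) ^ (1 / p)`. -/
def wass {X : Type*} [NormedAddCommGroup X] [MeasurableSpace X] (p : ℝ) (μ ν : Measure X) :
    ℝ≥0∞ :=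
  ⨅ (γ : Measure (X × X)) (_ : IsCoupling γ μ ν), (∫⁻ z, ‖z.1 - z.2‖ₑ ^ p ∂γ) ^ (1 / p)

/-! ### Spaces

All norms below are Mathlib's norms on finite products, i.e. max norms. -/

/-- The values `u = (x, z)` of the data chain. -/
abbrev Data (d dZ : ℕ) : Type := (Fin d → ℝ) × (Fin dZ → ℝ)

/-- First derivatives `(s^A, s^W)`; the entry `(i, j, k)` is the derivative of the `k`-th hidden
unit with respect to `A i j`, respectively `W i j`. -/
abbrev FirstDeriv (d N : ℕ) : Type :=
  (Fin N × Fin d × Fin N → ℝ) × (Fin N × Fin N × Fin N → ℝ)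

/-- Second derivatives `(s^AA, s^WA, s^WW)`; the entry `(n, m, i, j, k)` is the derivative of the
`k`-th hidden unit with respect to the entries `(n, m)` and `(i, j)` of the matrices named. -/
abbrev SecondDeriv (d N : ℕ) : Type :=
  (Fin N × Fin d × Fin N × Fin d × Fin N → ℝ) ×
  (Fin N × Fin N × Fin N × Fin d × Fin N → ℝ) ×
  (Fin N × Fin N × Fin N × Fin N × Fin N → ℝ)

/-- The values `v = (s, s', s'')` of the hidden state with its first and second derivatives. -/
abbrev Hidden (d N : ℕ) : Type := (Fin N → ℝ) × FirstDeriv d N × SecondDeriv d N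

/-- The state space of the joint chain, with points `h = (u, v, η)`. -/
abbrev State (d dZ N : ℕ) : Type := Data d dZ × Hidden d N × ℝ

/-- The parameters `θ = (A, W, B, c)` of the network. -/
structure Params (d N : ℕ) where
  A : Matrix (Fin N) (Fin d) ℝ
  W : Matrix (Fin N) (Fin N) ℝ
  B : Fin N → ℝ
  c : ℝ

/-! ### The forward recursion -/

section Recursion

variable {d dZ N : ℕ} (φ : ℝ → ℝ) (θ : Params d N) (x : Fin d → ℝ) (s : Fin N → ℝ)
  (s₁ : FirstDeriv d N) (s₂ : SecondDeriv d N)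

/-- The Kronecker symbol of a proposition. -/
def ind (p : Prop) [Decidable p] : ℝ := if p then 1 else 0

/-- The argument of the activation function of the `k`-th hidden unit. -/
def pre (k : Fin N) : ℝ :=
  1 / d * ∑ j, φ (θ.A k j) * x j + 1 / N * ∑ l, φ (θ.W k l) * s l

/-- First derivative of `pre` with respect to `A i j`. -/
def preA (i : Fin N) (j : Fin d) (k : Fin N) : ℝ :=
  1 / d * ind (i = k) * deriv φ (θ.A i j) * x j + 1 / N * ∑ l, φ (θ.W k l) * s₁.1 (i, j, l)

/-- First derivative of `pre` with respect to `W i j`. -/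
def preW (i j k : Fin N) : ℝ :=
  1 / N * ind (i = k) * deriv φ (θ.W i j) * s j + 1 / N * ∑ l, φ (θ.W k l) * s₁.2 (i, j, l)

/-- Second derivative of `pre` with respect to `A n m` and `A i j`. -/
def preAA (n : Fin N) (m : Fin d) (i : Fin N) (j : Fin d) (k : Fin N) : ℝ :=
  1 / d * ind (i = k) * ind (i = n ∧ j = m) * deriv (deriv φ) (θ.A i j) * x j
    + 1 / N * ∑ l, φ (θ.W k l) * s₂.1 (i, j, n, m, l)

/-- Second derivative of `pre` with respect to `W n m` and `A i j`. -/
def preWA (n m i : Fin N) (j : Fin d) (k : Fin N) : ℝ :=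
  1 / N * ind (k = n) * deriv φ (θ.W n m) * s₁.1 (i, j, m)
    + 1 / N * ∑ l, φ (θ.W k l) * s₂.2.1 (n, m, i, j, l)

/-- Second derivative of `pre` with respect to `W n m` and `W i j`. -/
def preWW (n m i j k : Fin N) : ℝ :=
  1 / N * ind (i = k) * ind (i = n ∧ j = m) * deriv (deriv φ) (θ.W i j) * s j
    + 1 / N * ind (i = k) * deriv φ (θ.W i j) * s₁.2 (n, m, j)
    + 1 / N * ind (k = n) * deriv φ (θ.W n m) * s₁.2 (i, j, m)
    + 1 / N * ∑ l, φ (θ.W k l) * s₂.2.2 (n, m, i, j, l)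

/-- One step of the hidden state: `S_{t+1} = σ(pre)` with the sigmoid `σ`. -/
def stepS (k : Fin N) : ℝ := Real.sigmoid (pre φ θ x s k)

/-- One step of the first derivatives, by the chain rule. -/
def stepFirst : FirstDeriv d N :=
  (fun ⟨i, j, k⟩ => deriv Real.sigmoid (pre φ θ x s k) * preA φ θ x s₁ i j k,
   fun ⟨i, j, k⟩ => deriv Real.sigmoid (pre φ θ x s k) * preW φ θ s s₁ i j k)

/-- One step of the second derivatives, by the chain rule. -/
def stepSecond : SecondDeriv d N :=
  (fun ⟨n, m, i, j, k⟩ =>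
    deriv (deriv Real.sigmoid) (pre φ θ x s k) * preA φ θ x s₁ n m k * preA φ θ x s₁ i j k
      + deriv Real.sigmoid (pre φ θ x s k) * preAA φ θ x s₂ n m i j k,
   fun ⟨n, m, i, j, k⟩ =>
    deriv (deriv Real.sigmoid) (pre φ θ x s k) * preW φ θ s s₁ n m k * preA φ θ x s₁ i j k
      + deriv Real.sigmoid (pre φ θ x s k) * preWA φ θ s₁ s₂ n m i j k,
   fun ⟨n, m, i, j, k⟩ =>
    deriv (deriv Real.sigmoid) (pre φ θ x s k) * preW φ θ s s₁ n m k * preW φ θ s s₁ i j k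
      + deriv Real.sigmoid (pre φ θ x s k) * preWW φ θ s s₁ s₂ n m i j k)

/-- The map `F^θ` with `V_{t+1} = F^θ(U_t, V_t)`. -/
def step (p : Data d dZ × Hidden d N) : Hidden d N :=
  (stepS φ θ p.1.1 p.2.1, stepFirst φ θ p.1.1 p.2.1 p.2.2.1,
    stepSecond φ θ p.1.1 p.2.1 p.2.2.1 p.2.2.2)

theorem measurable_step : Measurable (step (dZ := dZ) φ θ) := by
  have h0 : Measurable Real.sigmoid := by unfold Real.sigmoid; fun_prop
  have h1 : Measurable (deriv Real.sigmoid) := measurable_deriv _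
  have h2 : Measurable (deriv (deriv Real.sigmoid)) := measurable_deriv _
  unfold step stepS stepFirst stepSecond pre preA preW preAA preWA preWW
  fun_prop

end Recursion

/-! ### The joint chain -/

/-- The transition kernel of the joint chain: from `(u, v, η)`, independently, `u` moves by the
kernel `κ` of the data chain, `v` moves to `F^θ(u, v)`, and `η` is redrawn from `ν`. -/
def jointKernel {d dZ N : ℕ} (κ : Kernel (Data d dZ) (Data d dZ)) (ν : Measure ℝ) (φ : ℝ → ℝ)
    (θ : Params d N) : Kernel (State d dZ N) (State d dZ N) :=
  (κ.comap (fun h : State d dZ N => h.1) measurable_fst) ×ₖ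
    ((Kernel.deterministic (fun h : State d dZ N => step φ θ (h.1, h.2.1))
        ((measurable_step φ θ).comp (by fun_prop))) ×ₖ
      (Kernel.const (State d dZ N) ν))

/-- The law at time `t` of a Markov chain with transition kernel `κ` and initial law `ρ`. -/
def lawAt {X : Type*} [MeasurableSpace X] (κ : Kernel X X) (ρ : Measure X) (t : ℕ) : Measure X :=
  ρ.bind (κ ^ t : Kernel X X)

/-- The data chain with initial law `ρ` satisfies `‖(X_t, Z_t)‖ ≤ 1` almost surely, for all `t`. -/
def StaysInUnitBox {d dZ : ℕ} (κ : Kernel (Data d dZ) (Data d dZ)) (ρ : Measure (Data d dZ)) :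
    Prop :=
  ∀ t : ℕ, ∀ᵐ u ∂(lawAt κ ρ t), ‖u‖ ≤ 1

/-! ### The constants -/

/-- `M_φ = 1 + C_φ / (4 - C_φ)`. -/
def constM (C : ℝ) : ℝ := 1 + C / (4 - C)

/-- `L₀`, for bounds `C`, `C₁` on `|φ|`, `|φ'|`. -/
def constL0 (d N : ℕ) (C C₁ : ℝ) : ℝ :=
  max (3 * C₁ / (min N d : ℝ) * (C * constM C / 10 + 1 / 4)) (3 * C / 4)

/-- `L₂`, for bounds `C`, `C₁`, `C₂` on `|φ|`, `|φ'|`, `|φ''|`. -/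
def constL2 (d N : ℕ) (C C₁ C₂ : ℝ) : ℝ :=
  max (C₂ / (min N d : ℝ)) (C₁ ^ 2 / (N * d * (4 - C)))

/-- `L₁`, for bounds `C`, `C₁`, `C₂` on `|φ|`, `|φ'|`, `|φ''|`. -/
def constL1 (d N : ℕ) (C C₁ C₂ : ℝ) : ℝ :=
  max
    (4 * max
      (constM C * C ^ 2 / (5 * (min d N : ℝ) ^ 2)
        + C * constM C ^ 2 * C₁ ^ 2 / (8 * (min d N : ℝ) ^ 2)
        + C₂ / (4 * (min N d : ℝ))
        + C / 10 * (constL2 d N C C₁ C₂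
            + C / (1 - C / 4) *
              (C ^ 2 * constM C ^ 2 / (10 * (min N d : ℝ) ^ 2) + 1 / 4 * constL2 d N C C₁ C₂)))
      (C * constM C * C₁ / (5 * (min N d : ℝ)) + C₁ / (4 * N)))
    C

/-- `L = max L₀ L₁`. -/
def constL (d N : ℕ) (C C₁ C₂ : ℝ) : ℝ := max (constL0 d N C C₁) (constL1 d N C C₁ C₂)

end RNN

end

/-!
The constant `L` dominates `C`, and this is all that is needed of it: the rate `q` satisfies
`q ^ 2 ≥ Lκ ^ 2 + C ^ 2`, while the data chain contracts at the rate `Lκ` and each of the three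
layers `s`, `s'`, `s''` of the hidden state contracts, on its own, at the rate `C / 4`.

*Contraction.* For data in the unit box, the recursion preserves a box of hidden states, large
enough to contain any prescribed ball.  On it the recursion is triangular: the increment of each
layer is `C / 4` times its previous increment plus a multiple of those of the data and of the lower
layers.  A weighted norm with small weights on the derivatives therefore contracts by `C / 2`, up to
`C / 2` times the increment of the data (`exists_box_contraction`).  The weights depend on the size
of the box, but not on the network parameters.  If the data are coupled nearly optimally and the
noise is shared, the squared distance of the data plus the squared weighted distance of the hidden
states is multiplied by at most `Lκ ^ 2 + C ^ 2` in one step.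

*From points to laws.* To use this along the chain, couplings of the transition laws from pairs of
points must be combined into a coupling of the laws at the next time.  A measurable choice of
couplings is avoided: the current coupling is approximated by finitely supported ones, for which
there is nothing to choose, and the resulting couplings have a weak limit point by Prokhorov's
theorem, along which the cost is lower semicontinuous (`exists_isCoupling_of_tendsto`,
`exists_isCoupling_bind`).  Iterating gives the exponential merging of any two chains with good data
(`exists_wass_lawAt_le`).

*The invariant law.* The laws of the chain started from a good data point and the zero hidden state
are tight and merge with their one-step shifts, so that a weak limit point is invariant by the
Feller property (`exists_invariant_jointKernel`).  Merging with this law is the claimed convergence.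
For uniqueness on the whole space, the data marginal of any invariant law lives on the good data
points, because the mean of a capped distance to the unit box contracts along the data chain
(`staysInUnitBox_of_invariant`); from each such point, whatever the hidden state and the noise, the
chain converges weakly to the invariant law found before, and averaging over the starting point
gives equality.
-/

namespace RNN

/-! ### Couplings and weak convergence -/

section Couplings

theorem IsCoupling.isProbabilityMeasure {X : Type*} [MeasurableSpace X] {γ : Measure (X × X)} 
    {μ ν : Measure X} [IsProbabilityMeasure μ] (h : IsCoupling γ μ ν) : IsProbabilityMeasure γ := by
  constructor
  rw [← Set.preimage_univ (f := Prod.fst), ← Measure.map_apply measurable_fst .univ, h.1,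
    measure_univ]

variable {X : Type*} [NormedAddCommGroup X] [MeasurableSpace X]

theorem wass_two_le_of_isCoupling {γ : Measure (X × X)} {μ ν : Measure X} (h : IsCoupling γ μ ν)
    {B : ℝ} (hB : ∫⁻ z, ‖z.1 - z.2‖ₑ ^ (2 : ℝ) ∂γ ≤ ENNReal.ofReal B) :
    wass 2 μ ν ≤ ENNReal.ofReal (Real.sqrt B) := by
  refine (iInf₂_le γ h).trans ?_
  refine (ENNReal.rpow_le_rpow hB (by norm_num)).trans ?_
  rcases le_or_gt 0 B with hB0 | hB0
  · rw [ENNReal.ofReal_rpow_of_nonneg hB0 (by norm_num), Real.sqrt_eq_rpow]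
  · simp [ENNReal.ofReal_of_nonpos hB0.le]

/-- A coupling whose cost is arbitrarily close to the square of a bound on the distance. -/
theorem exists_isCoupling_of_wass_two_le {μ ν : Measure X} {b ε : ℝ} (hε : 0 < ε)
    (h : wass 2 μ ν ≤ ENNReal.ofReal b) :
    ∃ γ, IsCoupling γ μ ν ∧
      ∫⁻ z, ‖z.1 - z.2‖ₑ ^ (2 : ℝ) ∂γ ≤ ENNReal.ofReal (b ^ 2 + ε) := by
  have hlt : wass 2 μ ν < ENNReal.ofReal (Real.sqrt (b ^ 2 + ε)) := by
    refine h.trans_lt ((ENNReal.ofReal_lt_ofReal_iff (by positivity)).2 ?_)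
    exact Real.lt_sqrt_of_sq_lt (by linarith)
  rw [wass, iInf_lt_iff] at hlt
  obtain ⟨γ, hγ⟩ := hlt
  rw [iInf_lt_iff] at hγ
  obtain ⟨hc, hγ⟩ := hγ
  refine ⟨γ, hc, ?_⟩
  have := ENNReal.rpow_le_rpow hγ.le (z := 2) (by norm_num)
  rwa [← ENNReal.rpow_mul, ENNReal.ofReal_rpow_of_nonneg (by positivity) (by norm_num),
    Real.rpow_two, Real.sq_sqrt (by positivity), one_div, inv_mul_cancel₀ two_ne_zero,
    ENNReal.rpow_one] at this

variable [BorelSpace X] [SecondCountableTopology X]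

theorem abs_integral_sub_le_wass {μ ν : Measure X} [IsProbabilityMeasure μ]
    [IsProbabilityMeasure ν] {f : X → ℝ} {ℓ : ℝ≥0} (hℓ : 0 < ℓ)
    (hf : LipschitzWith ℓ f) {B : ℝ}
    (hB : ∀ x, |f x| ≤ B) :
    ENNReal.ofReal |∫ x, f x ∂μ - ∫ x, f x ∂ν| ≤ ℓ * wass 2 μ ν := by
  have hfm : Measurable f := hf.continuous.measurable
  rw [wass, ENNReal.mul_iInf_of_ne (by simpa using hℓ.ne') (by simp)]
  refine le_iInf fun γ => ?_
  rw [ENNReal.mul_iInf_of_ne (by simpa using hℓ.ne') (by simp)]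
  refine le_iInf fun hγ => ?_
  have := hγ.isProbabilityMeasure
  have hint : ∀ g : X × X → X, Measurable g → Integrable (fun z => f (g z)) γ := fun g hg =>
    Integrable.of_bound (hfm.comp hg).aestronglyMeasurable B (.of_forall fun z => hB _)
  rw [← hγ.1, ← hγ.2, integral_map (by fun_prop) hfm.aestronglyMeasurable,
    integral_map (by fun_prop) hfm.aestronglyMeasurable,
    ← integral_sub (hint _ measurable_fst) (hint _ measurable_snd), ← Real.norm_eq_abs,
    ofReal_norm]
  refine (enorm_integral_le_lintegral_enorm _).trans ?_
  have hle : ∀ z : X × X, ‖f z.1 - f z.2‖ₑ ≤ ℓ * ‖z.1 - z.2‖ₑ := fun z => by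
    rw [← edist_eq_enorm_sub, ← edist_eq_enorm_sub]; exact hf _ _
  refine (lintegral_mono hle).trans ?_
  rw [lintegral_const_mul _ (by fun_prop)]
  gcongr
  have := ENNReal.lintegral_mul_le_Lp_mul_Lq γ Real.HolderConjugate.two_two
    (f := fun z : X × X => ‖z.1 - z.2‖ₑ) (g := fun _ => 1) (by fun_prop) (by fun_prop)
  simpa using this

/-- Weak convergence is insensitive to perturbations that vanish in the Wasserstein distance. -/
theorem tendsto_of_tendsto_of_tendsto_wass {ι : Type*} {F : Filter ι} [F.IsCountablyGenerated]
    {μs νs : ι → ProbabilityMeasure X} {μ : ProbabilityMeasure X} (hμ : Tendsto μs F (𝓝 μ))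
    (h : Tendsto (fun i => wass 2 (νs i : Measure X) (μs i)) F (𝓝 0)) : Tendsto νs F (𝓝 μ) := by
  rw [tendsto_iff_forall_lipschitz_integral_tendsto] at hμ ⊢
  intro f hfC hfL
  have hlim := hμ f hfC hfL
  obtain ⟨C, hC⟩ := hfC
  obtain ⟨ℓ, hℓ⟩ := hfL
  obtain ⟨x₀⟩ : Nonempty X := nonempty_of_isProbabilityMeasure (μ : Measure X)
  have hB : ∀ x, |f x| ≤ |f x₀| + C := fun x => by
    have := hC x x₀
    rw [Real.dist_eq] at this
    have h2 := abs_sub_abs_le_abs_sub (f x) (f x₀)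
    linarith
  replace hℓ : LipschitzWith (ℓ + 1) f := hℓ.weaken le_self_add
  have h0 : Tendsto (fun i => ((ℓ + 1 : ℝ≥0) * wass 2 (νs i : Measure X) (μs i) : ℝ≥0∞)) F
      (𝓝 0) := by
    simpa using ENNReal.Tendsto.const_mul h (.inr (ENNReal.coe_ne_top (r := ℓ + 1)))
  have h1 : Tendsto (fun i => ENNReal.ofReal
      |∫ x, f x ∂(νs i : Measure X) - ∫ x, f x ∂(μs i : Measure X)|) F (𝓝 0) :=
    tendsto_of_tendsto_of_tendsto_of_le_of_le tendsto_const_nhds h0 (fun _ => zero_le)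
      fun i => abs_integral_sub_le_wass (by positivity) hℓ hB
  have h2 := (ENNReal.tendsto_toReal ENNReal.zero_ne_top).comp h1
  simp only [Function.comp_def, ENNReal.toReal_ofReal (abs_nonneg _), ENNReal.toReal_zero] at h2
  have h3 := ((tendsto_zero_iff_abs_tendsto_zero _).2 h2).add hlim
  simpa using h3

/-- Convergence in the Wasserstein distance implies weak convergence. -/
theorem tendsto_of_tendsto_wass {ι : Type*} {F : Filter ι} [F.IsCountablyGenerated]
    {μs : ι → ProbabilityMeasure X} {μ : ProbabilityMeasure X}
    (h : Tendsto (fun i => wass 2 (μs i : Measure X) μ) F (𝓝 0)) : Tendsto μs F (𝓝 μ) :=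
  tendsto_of_tendsto_of_tendsto_wass (μs := fun _ => μ) tendsto_const_nhds h

variable [CompleteSpace X]

theorem isTightMeasureSet_range_of_tendsto {μs : ℕ → ProbabilityMeasure X}
    {μ : ProbabilityMeasure X} (h : Tendsto μs atTop (𝓝 μ)) :
    IsTightMeasureSet (Set.range fun n => (μs n : Measure X)) := by
  have := isTightMeasureSet_of_isCompact_closure (S := insert μ (Set.range μs))
    (by rw [h.isCompact_insert_range.isClosed.closure_eq]; exact h.isCompact_insert_range)
  refine this.subset ?_
  rintro _ ⟨n, rfl⟩
  exact ⟨μs n, .inr ⟨n, rfl⟩, rfl⟩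

theorem exists_subseq_tendsto_of_isTightMeasureSet {Y : Type*} [MetricSpace Y]
    [MeasurableSpace Y] [BorelSpace Y] [SecondCountableTopology Y] {μs : ℕ → ProbabilityMeasure Y}
    (h : IsTightMeasureSet (Set.range fun n => (μs n : Measure Y))) :
    ∃ (μ : ProbabilityMeasure Y) (φ : ℕ → ℕ), StrictMono φ ∧
      Tendsto (μs ∘ φ) atTop (𝓝 μ) := by
  have hc : IsCompact (closure (Set.range μs)) :=
    isCompact_closure_of_isTightMeasureSet (h.subset (by rintro _ ⟨_, ⟨n, rfl⟩, rfl⟩; exact ⟨n, rfl⟩))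
  obtain ⟨μ, -, φ, hφ, hμ⟩ := hc.tendsto_subseq (x := μs) fun n => subset_closure ⟨n, rfl⟩
  exact ⟨μ, φ, hφ, hμ⟩

/-- Couplings pass to weak limits of the marginals, and a continuous cost does not increase.
This is compactness of the set of couplings together with lower semicontinuity of the cost. -/
theorem exists_isCoupling_of_tendsto {μs νs : ℕ → ProbabilityMeasure X}
    {μ ν : ProbabilityMeasure X} (hμ : Tendsto μs atTop (𝓝 μ)) (hν : Tendsto νs atTop (𝓝 ν))
    {Γs : ℕ → Measure (X × X)} (hΓ : ∀ n, IsCoupling (Γs n) (μs n) (νs n))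
    {c : X × X → ℝ} (hc : Continuous c) (hc0 : ∀ z, 0 ≤ c z) {a : ℕ → ℝ≥0∞} {b : ℝ≥0∞}
    (ha : ∀ n, ∫⁻ z, ENNReal.ofReal (c z) ∂(Γs n) ≤ a n) (hab : Tendsto a atTop (𝓝 b)) :
    ∃ Γ, IsCoupling Γ (μ : Measure X) ν ∧ ∫⁻ z, ENNReal.ofReal (c z) ∂Γ ≤ b := by
  let Γp : ℕ → ProbabilityMeasure (X × X) := fun n => ⟨Γs n, (hΓ n).isProbabilityMeasure⟩
  have htight : IsTightMeasureSet (Set.range fun n => (Γp n : Measure (X × X))) := by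
    refine .prodMk ((isTightMeasureSet_range_of_tendsto hμ).subset ?_)
      ((isTightMeasureSet_range_of_tendsto hν).subset ?_)
    · rintro _ ⟨_, ⟨n, rfl⟩, rfl⟩; exact ⟨n, (hΓ n).1.symm⟩
    · rintro _ ⟨_, ⟨n, rfl⟩, rfl⟩; exact ⟨n, (hΓ n).2.symm⟩
  obtain ⟨Γ, φ, hφ, hlim⟩ := exists_subseq_tendsto_of_isTightMeasureSet htight
  refine ⟨Γ, ⟨?_, ?_⟩, ?_⟩
  · have h1 := ((ProbabilityMeasure.continuous_map continuous_fst).tendsto Γ).comp hlim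
    have h2 : Tendsto (μs ∘ φ) atTop (𝓝 μ) := hμ.comp hφ.tendsto_atTop
    have h3 := tendsto_nhds_unique h1 (h2.congr fun n => Subtype.ext (hΓ (φ n)).1.symm)
    exact congrArg Subtype.val h3
  · have h1 := ((ProbabilityMeasure.continuous_map continuous_snd).tendsto Γ).comp hlim
    have h2 : Tendsto (νs ∘ φ) atTop (𝓝 ν) := hν.comp hφ.tendsto_atTop
    have h3 := tendsto_nhds_unique h1 (h2.congr fun n => Subtype.ext (hΓ (φ n)).2.symm)
    exact congrArg Subtype.val h3
  · refine (lintegral_le_liminf_lintegral_of_forall_isOpen_measure_le_liminf_measure hc hc0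
      fun G hG => ProbabilityMeasure.le_liminf_measure_open_of_tendsto hlim hG).trans ?_
    refine (liminf_le_liminf (.of_forall fun n => ha (φ n))).trans ?_
    exact (hab.comp hφ.tendsto_atTop).liminf_eq.le

end Couplings

/-! ### Laws of Markov chains -/

section LawAt

variable {X : Type*} [MeasurableSpace X]

theorem lawAt_zero (P : Kernel X X) (μ : Measure X) : lawAt P μ 0 = μ := by
  change μ.bind (Kernel.id : Kernel X X) = μ
  exact Measure.id_comp

theorem lawAt_succ (P : Kernel X X) (μ : Measure X) (t : ℕ) :
    lawAt P μ (t + 1) = (lawAt P μ t).bind P := by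
  rw [lawAt, lawAt, pow_succ']
  exact (Measure.comp_assoc).symm

theorem lawAt_succ' (P : Kernel X X) (μ : Measure X) (t : ℕ) :
    lawAt P μ (t + 1) = lawAt P (μ.bind P) t := by
  rw [lawAt, lawAt, pow_succ]
  exact (Measure.comp_assoc).symm

theorem isProbabilityMeasure_lawAt (P : Kernel X X) [IsMarkovKernel P] (μ : Measure X)
    [IsProbabilityMeasure μ] (t : ℕ) : IsProbabilityMeasure (lawAt P μ t) := by
  induction t with
  | zero => rwa [lawAt_zero]
  | succ t ih =>
    rw [lawAt_succ]
    exact isProbabilityMeasure_bind P.measurable.aemeasurable (.of_forall fun _ => inferInstance)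

theorem lawAt_of_invariant {P : Kernel X X} {μ : Measure X} (h : Kernel.Invariant P μ) (t : ℕ) :
    lawAt P μ t = μ := by
  induction t with
  | zero => rw [lawAt_zero]
  | succ t ih => rw [lawAt_succ, ih]; exact h

theorem ae_mem_lawAt {P : Kernel X X} {R : Set X} (hRm : MeasurableSet R)
    (hR : ∀ x ∈ R, ∀ᵐ y ∂(P x), y ∈ R)
    {μ : Measure X} (hμ : ∀ᵐ x ∂μ, x ∈ R) (t : ℕ) : ∀ᵐ x ∂(lawAt P μ t), x ∈ R := by
  induction t with
  | zero => rwa [lawAt_zero]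
  | succ t ih =>
    rw [lawAt_succ]
    exact Measure.ae_comp_of_ae_ae hRm (ih.mono hR)

end LawAt

/-! ### Transporting couplings along a Feller kernel -/

section Transport

theorem map_bind_eq {α β δ : Type*} [MeasurableSpace α] [MeasurableSpace β] [MeasurableSpace δ]
    {m : Measure α} {f : α → Measure β} (hf : Measurable f) {g : β → δ} (hg : Measurable g) :
    (m.bind f).map g = m.bind fun a => (f a).map g := by
  refine Measure.ext fun s hs => ?_
  rw [Measure.map_apply hg hs, Measure.bind_apply (hg hs) hf.aemeasurable,
    Measure.bind_apply (f := fun a => (f a).map g) hs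
      ((Measure.measurable_map g hg).comp hf).aemeasurable]
  exact lintegral_congr fun a => (Measure.map_apply hg hs).symm

theorem bind_map_eq {α β δ : Type*} [MeasurableSpace α] [MeasurableSpace β] [MeasurableSpace δ]
    {m : Measure α} {g : α → β} (hg : Measurable g) {f : β → Measure δ} (hf : Measurable f) :
    (m.map g).bind f = m.bind fun a => f (g a) := by
  refine Measure.ext fun s hs => ?_
  rw [Measure.bind_apply hs hf.aemeasurable, Measure.bind_apply (f := fun a => f (g a)) hs
    (hf.comp hg).aemeasurable,
    lintegral_map (Measure.measurable_measure.1 hf s hs) hg]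

variable {X : Type*} [NormedAddCommGroup X] [MeasurableSpace X] [BorelSpace X]

/-- A kernel is Feller if its transition laws depend continuously, for weak convergence, on the
starting point. -/
def IsFeller (P : Kernel X X) [IsMarkovKernel P] : Prop :=
  Continuous (Y := ProbabilityMeasure X) fun x => ⟨P x, inferInstance⟩

theorem IsFeller.tendsto_bind {P : Kernel X X} [IsMarkovKernel P] (hP : IsFeller P)
    {α : Type*} [MeasurableSpace α] {m : Measure α} [IsProbabilityMeasure m] {g : α → X}
    {gs : ℕ → α → X} (hg : Measurable g) (hgs : ∀ n, Measurable (gs n))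
    (hlim : ∀ᵐ a ∂m, Tendsto (fun n => gs n a) atTop (𝓝 (g a)))
    {μ : ProbabilityMeasure X} {μs : ℕ → ProbabilityMeasure X}
    (hμ : (μ : Measure X) = m.bind fun a => P (g a))
    (hμs : ∀ n, (μs n : Measure X) = m.bind fun a => P (gs n a)) :
    Tendsto μs atTop (𝓝 μ) := by
  rw [ProbabilityMeasure.tendsto_iff_forall_lintegral_tendsto]
  intro f
  have hfm : Measurable fun x => (f x : ℝ≥0∞) := by fun_prop
  simp_rw [hμ, hμs]
  rw [Measure.lintegral_bind (μ := fun a => P (g a)) (P.measurable.comp hg).aemeasurable hfm.aemeasurable]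
  simp_rw [fun n => Measure.lintegral_bind (m := m) (μ := fun a => P (gs n a))
    (P.measurable.comp (hgs n)).aemeasurable
    hfm.aemeasurable]
  refine tendsto_lintegral_of_dominated_convergence (fun _ => (nndist 0 f : ℝ≥0∞)) (fun n => ?_)
    (fun n => ?_) (by simp) ?_
  · exact (Measure.measurable_lintegral hfm).comp (P.measurable.comp (hgs n))
  · exact .of_forall fun a => by
      have := f.lintegral_le_edist_mul (P (gs n a))
      simpa using this
  · filter_upwards [hlim] with a ha
    exact ProbabilityMeasure.tendsto_iff_forall_lintegral_tendsto.1
      ((hP.tendsto (g a)).comp ha) f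

theorem IsFeller.tendsto_bind_right {P : Kernel X X} [IsMarkovKernel P] (hP : IsFeller P)
    {ι : Type*} {F : Filter ι} {μs νs : ι → ProbabilityMeasure X} {μ ν : ProbabilityMeasure X}
    (hμ : Tendsto μs F (𝓝 μ)) (hνs : ∀ i, (νs i : Measure X) = (μs i : Measure X).bind P)
    (hν : (ν : Measure X) = (μ : Measure X).bind P) : Tendsto νs F (𝓝 ν) := by
  rw [ProbabilityMeasure.tendsto_iff_forall_lintegral_tendsto] at hμ ⊢
  intro f
  have hfm : Measurable fun x => (f x : ℝ≥0∞) := by fun_prop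
  simp_rw [hν, hνs, Measure.lintegral_bind P.measurable.aemeasurable hfm.aemeasurable]
  have hle : ∀ x, ∫⁻ y, f y ∂(P x) ≤ nndist 0 f := fun x => by
    simpa using f.lintegral_le_edist_mul (P x)
  have hne : ∀ x, ∫⁻ y, f y ∂(P x) ≠ ∞ := fun x => ne_top_of_le_ne_top ENNReal.coe_ne_top (hle x)
  have hcont : Continuous fun x => (∫⁻ y, f y ∂(P x)).toNNReal :=
    continuous_iff_continuousAt.2 fun x => (ENNReal.tendsto_toNNReal (hne x)).comp
      (ProbabilityMeasure.tendsto_iff_forall_lintegral_tendsto.1 (hP.tendsto x) f)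
  let g : BoundedContinuousFunction X ℝ≥0 :=
    BoundedContinuousFunction.mkOfBound ⟨_, hcont⟩ (nndist 0 f) fun x y => by
      rw [NNReal.dist_eq, abs_sub_le_iff]
      have hb : ∀ z, ((∫⁻ y, f y ∂(P z)).toNNReal : ℝ) ≤ nndist 0 f := fun z => by
        exact_mod_cast ENNReal.toNNReal_mono ENNReal.coe_ne_top (hle z)
      constructor <;> simp only [ContinuousMap.coe_mk] <;>
        linarith [hb x, hb y, NNReal.coe_nonneg (∫⁻ w, f w ∂(P x)).toNNReal,
          NNReal.coe_nonneg (∫⁻ w, f w ∂(P y)).toNNReal]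
  have hg : ∀ x, ((g x : ℝ≥0) : ℝ≥0∞) = ∫⁻ y, f y ∂(P x) := fun x => ENNReal.coe_toNNReal (hne x)
  simpa only [hg] using hμ g

variable [SecondCountableTopology X]

/-- A kernel is Feller as soon as its transition laws depend continuously on the starting point in
the Wasserstein distance. -/
theorem isFeller_of_wass_le {P : Kernel X X} [IsMarkovKernel P] {b : X → X → ℝ}
    (hb : ∀ x, Tendsto (fun y => b y x) (𝓝 x) (𝓝 0))
    (h : ∀ x y, wass 2 (P x) (P y) ≤ ENNReal.ofReal (b x y)) : IsFeller P := by
  refine continuous_iff_continuousAt.2 fun x => tendsto_of_tendsto_wass ?_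
  have h0 : Tendsto (fun y => ENNReal.ofReal (b y x)) (𝓝 x) (𝓝 0) := by
    simpa using ENNReal.tendsto_ofReal (hb x)
  exact tendsto_of_tendsto_of_tendsto_of_le_of_le tendsto_const_nhds h0 (fun _ => zero_le)
    fun y => h y x


/-- A Feller chain whose laws are tight and merge in the Wasserstein distance with their one-step
shifts has an invariant law, which is a weak limit of the laws along a subsequence. -/
theorem exists_invariant_of_tendsto_wass {P : Kernel X X} [IsMarkovKernel P] (hP : IsFeller P)
    {μs : ℕ → ProbabilityMeasure X} (hμs : ∀ n, (μs (n + 1) : Measure X) = (μs n : Measure X).bind P)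
    (htight : IsTightMeasureSet (Set.range fun n => (μs n : Measure X)))
    (h : Tendsto (fun n => wass 2 (μs (n + 1) : Measure X) (μs n)) atTop (𝓝 0)) :
    ∃ (μ : ProbabilityMeasure X) (φ : ℕ → ℕ), StrictMono φ ∧ Tendsto (μs ∘ φ) atTop (𝓝 μ) ∧
      Kernel.Invariant P (μ : Measure X) := by
  obtain ⟨μ, φ, hφ, hlim⟩ := exists_subseq_tendsto_of_isTightMeasureSet htight
  refine ⟨μ, φ, hφ, hlim, ?_⟩
  have h1 : Tendsto (fun n => μs (φ n + 1)) atTop (𝓝 μ) :=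
    tendsto_of_tendsto_of_tendsto_wass hlim (h.comp hφ.tendsto_atTop)
  let μP : ProbabilityMeasure X := ⟨(μ : Measure X).bind P,
      isProbabilityMeasure_bind P.measurable.aemeasurable (.of_forall fun _ => inferInstance)⟩
  have h2 : Tendsto (fun n => μs (φ n + 1)) atTop (𝓝 μP) :=
    hP.tendsto_bind_right hlim (fun n => hμs (φ n)) rfl
  have h3 : μ = μP := tendsto_nhds_unique h1 h2
  exact (congrArg Subtype.val h3).symm

variable [CompleteSpace X]

/-- If any two points `x`, `y` of `R` admit couplings of `P x` and `P y` of cost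
(almost) at most `c' (x, y)`, then a coupling `Γ` of two laws on `R` can be transported to a
coupling of their images under `P`, of cost at most the integral of `c'`.  No measurable choice of
the pointwise couplings is made: `Γ` is approximated by laws with finite support, and the resulting
couplings have a weak limit point. -/
theorem exists_isCoupling_bind {P : Kernel X X} [IsMarkovKernel P] (hP : IsFeller P)
    {R : Set X} {c c' : X × X → ℝ} (hc : Continuous c) (hc0 : ∀ z, 0 ≤ c z)
    (hc' : Continuous c') {B : ℝ} (hB : ∀ x ∈ R, ∀ y ∈ R, c' (x, y) ≤ B)
    (hPc : ∀ x ∈ R, ∀ y ∈ R, ∀ ε > 0, ∃ γ, IsCoupling γ (P x) (P y) ∧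
      ∫⁻ z, ENNReal.ofReal (c z) ∂γ ≤ ENNReal.ofReal (c' (x, y)) + ENNReal.ofReal ε)
    {Γ : Measure (X × X)} [IsProbabilityMeasure Γ] (hΓ : ∀ᵐ z ∂Γ, z.1 ∈ R ∧ z.2 ∈ R) :
    ∃ Γ', IsCoupling Γ' ((Γ.map Prod.fst).bind P) ((Γ.map Prod.snd).bind P) ∧
      ∫⁻ z, ENNReal.ofReal (c z) ∂Γ' ≤ ∫⁻ z, ENNReal.ofReal (c' z) ∂Γ := by
  classical
  obtain ⟨z₀, hz₀'⟩ := hΓ.exists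
  have hz₀ : z₀ ∈ R ×ˢ R := hz₀'
  let T : ℕ → SimpleFunc (X × X) (X × X) := fun n =>
    SimpleFunc.approxOn id measurable_id (R ×ˢ R) z₀ hz₀ n
  have hT : ∀ n z, T n z ∈ R ×ˢ R := fun n z => SimpleFunc.approxOn_mem measurable_id hz₀ n z
  have hTlim : ∀ᵐ z ∂Γ, Tendsto (fun n => T n z) atTop (𝓝 z) := by
    filter_upwards [hΓ] with z hz
    exact SimpleFunc.tendsto_approxOn measurable_id hz₀ (x := z)
      (subset_closure (show z ∈ R ×ˢ R from hz))
  have hε : ∀ n : ℕ, (0 : ℝ) < 1 / (n + 1) := fun n => Nat.one_div_pos_of_nat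
  -- For each `n`, a coupling for every pair of points; it is only used at the finitely many
  -- values of `T n`.
  have hex : ∀ (n : ℕ) (z : X × X), ∃ γ : Measure (X × X), z ∈ R ×ˢ R →
      IsCoupling γ (P z.1) (P z.2) ∧
      ∫⁻ w, ENNReal.ofReal (c w) ∂γ ≤ ENNReal.ofReal (c' z) + ENNReal.ofReal (1 / (n + 1)) := by
    intro n z
    by_cases hz : z ∈ R ×ˢ R
    · obtain ⟨γ, hγ⟩ := hPc z.1 hz.1 z.2 hz.2 _ (hε n)
      exact ⟨γ, fun _ => hγ⟩
    · exact ⟨0, fun h => absurd h hz⟩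
  choose g hg using hex
  let k : ℕ → X × X → Measure (X × X) := fun n z => g n (T n z)
  have hk : ∀ n, Measurable (k n) := fun n => ((T n).map (g n)).measurable
  have hmap : ∀ n, IsCoupling (Γ.bind (k n)) (Γ.bind fun z => P (T n z).1)
      (Γ.bind fun z => P (T n z).2) := fun n => by
    constructor
    · rw [map_bind_eq (hk n) measurable_fst]
      congr 1; funext z; exact (hg n _ (hT n z)).1.1
    · rw [map_bind_eq (hk n) measurable_snd]
      congr 1; funext z; exact (hg n _ (hT n z)).1.2
  have hm1 : ∀ n, Measurable fun z => (T n z).1 := fun n => (T n).measurable.fst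
  have hm2 : ∀ n, Measurable fun z => (T n z).2 := fun n => (T n).measurable.snd
  have hpr : ∀ {h : X × X → X}, Measurable h → IsProbabilityMeasure (Γ.bind fun z => P (h z)) :=
    fun h => isProbabilityMeasure_bind (P.measurable.comp h).aemeasurable (.of_forall fun _ => inferInstance)
  have hcost : ∀ n, ∫⁻ w, ENNReal.ofReal (c w) ∂(Γ.bind (k n)) ≤
      ∫⁻ z, ENNReal.ofReal (c' (T n z)) ∂Γ + ENNReal.ofReal (1 / (n + 1)) := fun n => by
    rw [Measure.lintegral_bind (hk n).aemeasurable (by fun_prop)]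
    refine (lintegral_mono fun z => (hg n _ (hT n z)).2).trans ?_
    rw [lintegral_add_right _ (by fun_prop)]
    simp
  have hlim : Tendsto (fun n : ℕ => ∫⁻ z, ENNReal.ofReal (c' (T n z)) ∂Γ +
      ENNReal.ofReal (1 / (n + 1))) atTop (𝓝 (∫⁻ z, ENNReal.ofReal (c' z) ∂Γ)) := by
    have h2 : Tendsto (fun n : ℕ => ENNReal.ofReal (1 / ((n : ℝ) + 1))) atTop (𝓝 0) := by
      simpa using ENNReal.tendsto_ofReal (tendsto_one_div_add_atTop_nhds_zero_nat (𝕜 := ℝ))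
    rw [← add_zero (∫⁻ z, ENNReal.ofReal (c' z) ∂Γ)]
    refine Tendsto.add ?_ h2
    refine tendsto_lintegral_of_dominated_convergence (fun _ => ENNReal.ofReal B) (fun n => ?_)
      (fun n => ?_) (by simp) ?_
    · exact ENNReal.measurable_ofReal.comp (hc'.measurable.comp (T n).measurable)
    · exact .of_forall fun z => ENNReal.ofReal_le_ofReal (hB _ (hT n z).1 _ (hT n z).2)
    · filter_upwards [hTlim] with z hz
      exact ENNReal.tendsto_ofReal ((hc'.tendsto z).comp hz)
  have e1 : (Γ.map Prod.fst).bind P = Γ.bind fun z => P z.1 :=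
    bind_map_eq measurable_fst P.measurable
  have e2 : (Γ.map Prod.snd).bind P = Γ.bind fun z => P z.2 :=
    bind_map_eq measurable_snd P.measurable
  rw [e1, e2]
  exact exists_isCoupling_of_tendsto
    (μs := fun n => ⟨_, hpr (hm1 n)⟩) (νs := fun n => ⟨_, hpr (hm2 n)⟩)
    (μ := ⟨_, hpr measurable_fst⟩) (ν := ⟨_, hpr measurable_snd⟩)
    (hP.tendsto_bind measurable_fst hm1 (hTlim.mono fun z hz => hz.fst_nhds) rfl fun _ => rfl)
    (hP.tendsto_bind measurable_snd hm2 (hTlim.mono fun z hz => hz.snd_nhds) rfl fun _ => rfl)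
    hmap hc hc0 hcost hlim

/-- If `P` contracts the cost `c` on `R` by the factor `r`, even with the smaller cost `c₀` on the
right-hand side, then the laws of two chains started in `R` have couplings of cost decaying
like `r ^ t`. -/
theorem exists_isCoupling_lawAt {P : Kernel X X} [IsMarkovKernel P] (hP : IsFeller P)
    {R : Set X} (hRm : MeasurableSet R) (hR : ∀ x ∈ R, ∀ᵐ y ∂(P x), y ∈ R)
    {c c₀ : X × X → ℝ} (hc : Continuous c) (hc0 : ∀ z, 0 ≤ c z) (hc₀ : Continuous c₀)
    (hle : ∀ z, c₀ z ≤ c z) {B : ℝ} (hB : ∀ x ∈ R, ∀ y ∈ R, c₀ (x, y) ≤ B) {r : ℝ} (hr : 0 ≤ r)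
    (hPc : ∀ x ∈ R, ∀ y ∈ R, ∀ ε > 0, ∃ γ, IsCoupling γ (P x) (P y) ∧
      ∫⁻ z, ENNReal.ofReal (c z) ∂γ ≤ ENNReal.ofReal (r * c₀ (x, y)) + ENNReal.ofReal ε)
    {μ ν : Measure X} [IsProbabilityMeasure μ] (hμ : ∀ᵐ x ∂μ, x ∈ R) (hν : ∀ᵐ x ∂ν, x ∈ R)
    {Γ : Measure (X × X)} (hΓ : IsCoupling Γ μ ν) (t : ℕ) :
    ∃ Γ', IsCoupling Γ' (lawAt P μ t) (lawAt P ν t) ∧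
      ∫⁻ z, ENNReal.ofReal (c z) ∂Γ' ≤ ENNReal.ofReal (r ^ t) * ∫⁻ z, ENNReal.ofReal (c z) ∂Γ := by
  induction t with
  | zero => exact ⟨Γ, by simpa only [lawAt_zero] using hΓ, by simp⟩
  | succ t ih =>
    obtain ⟨Γt, hΓt, hcost⟩ := ih
    have := isProbabilityMeasure_lawAt P μ t
    have := hΓt.isProbabilityMeasure
    have h1 : ∀ᵐ z ∂Γt, z.1 ∈ R :=
      ae_of_ae_map measurable_fst.aemeasurable (by rw [hΓt.1]; exact ae_mem_lawAt hRm hR hμ t)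
    have h2 : ∀ᵐ z ∂Γt, z.2 ∈ R :=
      ae_of_ae_map measurable_snd.aemeasurable (by rw [hΓt.2]; exact ae_mem_lawAt hRm hR hν t)
    obtain ⟨Γ', hΓ', hcost'⟩ := exists_isCoupling_bind hP hc hc0 (c' := fun z => r * c₀ z)
      (by fun_prop) (B := r * B) (fun x hx y hy => by gcongr; exact hB x hx y hy) hPc
      (h1.and h2)
    refine ⟨Γ', by rw [lawAt_succ, lawAt_succ]; rwa [hΓt.1, hΓt.2] at hΓ', hcost'.trans ?_⟩
    calc ∫⁻ z, ENNReal.ofReal (r * c₀ z) ∂Γt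
        ≤ ∫⁻ z, ENNReal.ofReal r * ENNReal.ofReal (c z) ∂Γt := by
          refine lintegral_mono fun z => ?_
          rw [← ENNReal.ofReal_mul hr]
          exact ENNReal.ofReal_le_ofReal (by gcongr; exact hle z)
      _ = ENNReal.ofReal r * ∫⁻ z, ENNReal.ofReal (c z) ∂Γt :=
          lintegral_const_mul _ (by fun_prop)
      _ ≤ _ := by
          rw [pow_succ', ENNReal.ofReal_mul hr, mul_assoc]
          gcongr

end Transport

/-! ### The sigmoid and its derivatives -/

section Sigmoid

theorem deriv_deriv_sigmoid : deriv (deriv Real.sigmoid) = fun x =>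
    Real.sigmoid x * (1 - Real.sigmoid x) * (1 - 2 * Real.sigmoid x) := by
  funext x
  rw [Real.deriv_sigmoid]
  have h := Real.hasDerivAt_sigmoid x
  have h2 : HasDerivAt (fun x => Real.sigmoid x * (1 - Real.sigmoid x)) _ x :=
    h.mul (h.const_sub 1)
  rw [h2.deriv]
  ring

theorem abs_deriv_sigmoid_le (x : ℝ) : |deriv Real.sigmoid x| ≤ 1 / 4 := by
  have h0 := Real.sigmoid_nonneg x
  have h1 := Real.sigmoid_le_one x
  rw [Real.deriv_sigmoid, abs_of_nonneg (mul_nonneg h0 (by linarith))]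
  nlinarith [sq_nonneg (Real.sigmoid x - 1 / 2)]

theorem abs_deriv_deriv_sigmoid_le (x : ℝ) : |deriv (deriv Real.sigmoid) x| ≤ 1 := by
  have h0 := Real.sigmoid_nonneg x
  have h1 := Real.sigmoid_le_one x
  have h2 := abs_deriv_sigmoid_le x
  rw [Real.deriv_sigmoid] at h2
  rw [deriv_deriv_sigmoid, abs_mul]
  have h3 : |1 - 2 * Real.sigmoid x| ≤ 1 := abs_le.2 ⟨by linarith, by linarith⟩
  nlinarith [abs_nonneg (1 - 2 * Real.sigmoid x),
    abs_nonneg (Real.sigmoid x * (1 - Real.sigmoid x))]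

theorem abs_sigmoid_sub_le (x y : ℝ) : |Real.sigmoid x - Real.sigmoid y| ≤ 1 / 4 * |x - y| :=
  Convex.norm_image_sub_le_of_norm_deriv_le (s := Set.univ)
    (fun _ _ => differentiableAt_sigmoid) (fun z _ => abs_deriv_sigmoid_le z) convex_univ
    (Set.mem_univ y) (Set.mem_univ x)

theorem abs_deriv_sigmoid_sub_le (x y : ℝ) :
    |deriv Real.sigmoid x - deriv Real.sigmoid y| ≤ |x - y| := by
  have h := abs_sigmoid_sub_le x y
  simp only [Real.deriv_sigmoid]
  have hx0 := Real.sigmoid_nonneg x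
  have hx1 := Real.sigmoid_le_one x
  have hy0 := Real.sigmoid_nonneg y
  have hy1 := Real.sigmoid_le_one y
  generalize Real.sigmoid x = p at *
  generalize Real.sigmoid y = q at *
  have e : p * (1 - p) - q * (1 - q) = (p - q) * (1 - p - q) := by ring
  have h3 : |1 - p - q| ≤ 1 := abs_le.2 ⟨by linarith, by linarith⟩
  rw [e, abs_mul]
  nlinarith [abs_nonneg (p - q), abs_nonneg (x - y)]

theorem abs_deriv_deriv_sigmoid_sub_le (x y : ℝ) :
    |deriv (deriv Real.sigmoid) x - deriv (deriv Real.sigmoid) y| ≤ |x - y| := by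
  have h := abs_sigmoid_sub_le x y
  simp only [deriv_deriv_sigmoid]
  have hx0 := Real.sigmoid_nonneg x
  have hx1 := Real.sigmoid_le_one x
  have hy0 := Real.sigmoid_nonneg y
  have hy1 := Real.sigmoid_le_one y
  generalize Real.sigmoid x = p at *
  generalize Real.sigmoid y = q at *
  have e : p * (1 - p) * (1 - 2 * p) - q * (1 - q) * (1 - 2 * q) =
      (p - q) * (1 - 3 * (p + q) + 2 * (p ^ 2 + p * q + q ^ 2)) := by ring
  have h3 : |1 - 3 * (p + q) + 2 * (p ^ 2 + p * q + q ^ 2)| ≤ 4 := by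
    refine abs_le.2 ⟨?_, ?_⟩
    · nlinarith [sq_nonneg (p - q), sq_nonneg (p + q - 1)]
    · nlinarith [mul_nonneg hx0 hy0]
  rw [e, abs_mul]
  nlinarith [abs_nonneg (p - q), abs_nonneg (x - y)]

theorem continuous_deriv_sigmoid : Continuous (deriv Real.sigmoid) := by
  rw [Real.deriv_sigmoid]
  have := continuous_sigmoid
  fun_prop

theorem continuous_deriv_deriv_sigmoid : Continuous (deriv (deriv Real.sigmoid)) := by
  rw [deriv_deriv_sigmoid]
  have := continuous_sigmoid
  fun_prop

end Sigmoid

/-! ### Bounds for one step of the hidden state -/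

section Step

variable {d dZ N : ℕ} (φ : ℝ → ℝ) (θ : Params d N)

theorem continuous_step : Continuous (step (dZ := dZ) φ θ) := by
  have h0 := continuous_sigmoid
  have h1 := continuous_deriv_sigmoid
  have h2 := continuous_deriv_deriv_sigmoid
  unfold step stepS stepFirst stepSecond pre preA preW preAA preWA preWW
  fun_prop

theorem abs_one_div_mul_sum_le {n : ℕ} {a b : Fin n → ℝ} {A B : ℝ} (hA : 0 ≤ A) (hB : 0 ≤ B)
    (ha : ∀ j, |a j| ≤ A) (hb : ∀ j, |b j| ≤ B) : |1 / (n : ℝ) * ∑ j, a j * b j| ≤ A * B := by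
  have h : |∑ j, a j * b j| ≤ n * (A * B) := by
    refine (Finset.abs_sum_le_sum_abs _ _).trans ?_
    refine (Finset.sum_le_card_nsmul _ _ (A * B) fun j _ => ?_).trans (by simp)
    rw [abs_mul]
    exact mul_le_mul (ha j) (hb j) (abs_nonneg _) hA
  rw [abs_mul, abs_of_nonneg (by positivity : (0 : ℝ) ≤ 1 / n)]
  rcases Nat.eq_zero_or_pos n with rfl | hn
  · simp; positivity
  · have : (0 : ℝ) < n := by exact_mod_cast hn
    rw [one_div, inv_mul_le_iff₀ this]
    exact h

theorem abs_one_div_mul_le {n : ℕ} {a b A B : ℝ} (hA : 0 ≤ A) (ha : |a| ≤ A) (hb : |b| ≤ B)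
    (p q : Prop) [Decidable p] [Decidable q] : |1 / (n : ℝ) * ind p * ind q * a * b| ≤ A * B := by
  have h1 : |1 / (n : ℝ)| ≤ 1 := by
    rw [abs_of_nonneg (by positivity)]
    rcases Nat.eq_zero_or_pos n with rfl | hn
    · simp
    · exact (div_le_one (by exact_mod_cast hn)).2 (by exact_mod_cast hn)
  have hi : ∀ (p : Prop) [Decidable p], |ind p| ≤ 1 := fun p _ => by
    unfold ind; split_ifs <;> simp
  have h2 : |1 / (n : ℝ) * ind p * ind q| ≤ 1 := by
    rw [abs_mul, abs_mul]
    exact mul_le_one₀ (mul_le_one₀ h1 (abs_nonneg _) (hi p)) (abs_nonneg _) (hi q)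
  rw [abs_mul, abs_mul]
  refine mul_le_mul ?_ hb (abs_nonneg _) hA
  nlinarith [abs_nonneg a]

theorem abs_apply_le {ι : Type*} [Fintype ι] (f : ι → ℝ) (i : ι) : |f i| ≤ ‖f‖ :=
  norm_le_pi_norm f i

variable {φ} {C C₁ C₂ : ℝ} (hφ₀ : ∀ y, |φ y| ≤ C) (hφ₁ : ∀ y, |deriv φ y| ≤ C₁)
  (hφ₂ : ∀ y, |deriv (deriv φ) y| ≤ C₂)
variable (x x' : Fin d → ℝ) (s s' : Fin N → ℝ) (s₁ s₁' : FirstDeriv d N)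
  (s₂ s₂' : SecondDeriv d N)

include hφ₀ in
theorem abs_pre_le (k : Fin N) : |pre φ θ x s k| ≤ C * (‖x‖ + ‖s‖) := by
  have hC : 0 ≤ C := (abs_nonneg _).trans (hφ₀ 0)
  have h1 := abs_one_div_mul_sum_le (a := fun j => φ (θ.A k j)) hC (norm_nonneg x)
    (fun j => hφ₀ _) (abs_apply_le x)
  have h2 := abs_one_div_mul_sum_le (a := fun j => φ (θ.W k j)) hC (norm_nonneg s)
    (fun j => hφ₀ _) (abs_apply_le s)
  unfold pre
  refine (abs_add_le _ _).trans ?_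
  linarith

/-- A bound for the first derivatives `preA` and `preW`. -/
def bound1 (C C₁ X S S₁ : ℝ) : ℝ := C₁ * (X + S) + C * S₁

/-- A bound for the second derivatives `preAA`, `preWA` and `preWW`. -/
def bound2 (C C₁ C₂ X S S₁ S₂ : ℝ) : ℝ := C₂ * (X + S) + 2 * C₁ * S₁ + C * S₂

include hφ₀ hφ₁ in
theorem abs_preA_le (i : Fin N) (j : Fin d) (k : Fin N) :
    |preA φ θ x s₁ i j k| ≤ bound1 C C₁ ‖x‖ ‖s‖ ‖s₁‖ := by
  have hC : 0 ≤ C := (abs_nonneg _).trans (hφ₀ 0)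
  have hC₁ : 0 ≤ C₁ := (abs_nonneg _).trans (hφ₁ 0)
  have h1 := abs_one_div_mul_le (n := d) hC₁ (hφ₁ (θ.A i j)) (abs_apply_le x j) (i = k) True
  have h2 := abs_one_div_mul_sum_le (a := fun l => φ (θ.W k l)) (b := fun l => s₁.1 (i, j, l)) hC
    (norm_nonneg s₁) (fun j => hφ₀ _) (fun l => (abs_apply_le _ _).trans (norm_fst_le s₁))
  have h3 : 0 ≤ C₁ * ‖s‖ := by positivity
  simp only [ind, if_true, mul_one] at h1
  unfold preA bound1 ind
  refine (abs_add_le _ _).trans ?_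
  linarith

include hφ₀ hφ₁ in
theorem abs_preW_le (i j k : Fin N) :
    |preW φ θ s s₁ i j k| ≤ bound1 C C₁ ‖x‖ ‖s‖ ‖s₁‖ := by
  have hC : 0 ≤ C := (abs_nonneg _).trans (hφ₀ 0)
  have hC₁ : 0 ≤ C₁ := (abs_nonneg _).trans (hφ₁ 0)
  have h1 := abs_one_div_mul_le (n := N) hC₁ (hφ₁ (θ.W i j)) (abs_apply_le s j) (i = k) True
  have h2 := abs_one_div_mul_sum_le (a := fun l => φ (θ.W k l)) (b := fun l => s₁.2 (i, j, l)) hC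
    (norm_nonneg s₁) (fun j => hφ₀ _) (fun l => (abs_apply_le _ _).trans (norm_snd_le s₁))
  have h3 : 0 ≤ C₁ * ‖x‖ := by positivity
  simp only [ind, if_true, mul_one] at h1
  unfold preW bound1 ind
  refine (abs_add_le _ _).trans ?_
  linarith

include hφ₀ hφ₁ hφ₂ in
theorem abs_preAA_le (n : Fin N) (m : Fin d) (i : Fin N) (j : Fin d) (k : Fin N) :
    |preAA φ θ x s₂ n m i j k| ≤ bound2 C C₁ C₂ ‖x‖ ‖s‖ ‖s₁‖ ‖s₂‖ := by
  have hC : 0 ≤ C := (abs_nonneg _).trans (hφ₀ 0)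
  have hC₁ : 0 ≤ C₁ := (abs_nonneg _).trans (hφ₁ 0)
  have hC₂ : 0 ≤ C₂ := (abs_nonneg _).trans (hφ₂ 0)
  have h1 := abs_one_div_mul_le (n := d) hC₂ (hφ₂ (θ.A i j)) (abs_apply_le x j) (i = k)
    (i = n ∧ j = m)
  have h2 := abs_one_div_mul_sum_le (a := fun l => φ (θ.W k l))
    (b := fun l => s₂.1 (i, j, n, m, l)) hC
    (norm_nonneg s₂) (fun j => hφ₀ _) (fun l => (abs_apply_le _ _).trans (norm_fst_le s₂))
  have h3 : 0 ≤ C₂ * ‖s‖ := by positivity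
  have h4 : 0 ≤ C₁ * ‖s₁‖ := by positivity
  unfold preAA bound2
  refine (abs_add_le _ _).trans ?_
  linarith

include hφ₀ hφ₁ hφ₂ in
theorem abs_preWA_le (n m i : Fin N) (j : Fin d) (k : Fin N) :
    |preWA φ θ s₁ s₂ n m i j k| ≤ bound2 C C₁ C₂ ‖x‖ ‖s‖ ‖s₁‖ ‖s₂‖ := by
  have hC : 0 ≤ C := (abs_nonneg _).trans (hφ₀ 0)
  have hC₁ : 0 ≤ C₁ := (abs_nonneg _).trans (hφ₁ 0)
  have hC₂ : 0 ≤ C₂ := (abs_nonneg _).trans (hφ₂ 0)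
  have h1 := abs_one_div_mul_le (n := N) hC₁ (hφ₁ (θ.W n m))
    ((abs_apply_le s₁.1 (i, j, m)).trans (norm_fst_le s₁)) (k = n) True
  have h2 := abs_one_div_mul_sum_le (a := fun l => φ (θ.W k l))
    (b := fun l => s₂.2.1 (n, m, i, j, l)) hC (norm_nonneg s₂) (fun j => hφ₀ _)
    (fun l => (abs_apply_le _ _).trans ((norm_fst_le s₂.2).trans (norm_snd_le s₂)))
  have h3 : 0 ≤ C₂ * (‖x‖ + ‖s‖) := by positivity
  have h4 : 0 ≤ C₁ * ‖s₁‖ := by positivity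
  simp only [ind, if_true, mul_one] at h1
  unfold preWA bound2 ind
  refine (abs_add_le _ _).trans ?_
  linarith

include hφ₀ hφ₁ hφ₂ in
theorem abs_preWW_le (n m i j k : Fin N) :
    |preWW φ θ s s₁ s₂ n m i j k| ≤ bound2 C C₁ C₂ ‖x‖ ‖s‖ ‖s₁‖ ‖s₂‖ := by
  have hC : 0 ≤ C := (abs_nonneg _).trans (hφ₀ 0)
  have hC₁ : 0 ≤ C₁ := (abs_nonneg _).trans (hφ₁ 0)
  have hC₂ : 0 ≤ C₂ := (abs_nonneg _).trans (hφ₂ 0)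
  have h0 := abs_one_div_mul_le (n := N) hC₂ (hφ₂ (θ.W i j)) (abs_apply_le s j) (i = k)
    (i = n ∧ j = m)
  have h1 := abs_one_div_mul_le (n := N) hC₁ (hφ₁ (θ.W i j))
    ((abs_apply_le s₁.2 (n, m, j)).trans (norm_snd_le s₁)) (i = k) True
  have h1' := abs_one_div_mul_le (n := N) hC₁ (hφ₁ (θ.W n m))
    ((abs_apply_le s₁.2 (i, j, m)).trans (norm_snd_le s₁)) (k = n) True
  have h2 := abs_one_div_mul_sum_le (a := fun l => φ (θ.W k l))
    (b := fun l => s₂.2.2 (n, m, i, j, l)) hC (norm_nonneg s₂) (fun j => hφ₀ _)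
    (fun l => (abs_apply_le _ _).trans ((norm_snd_le s₂.2).trans (norm_snd_le s₂)))
  have h3 : 0 ≤ C₂ * ‖x‖ := by positivity
  simp only [ind, if_true, mul_one] at h0 h1 h1'
  unfold preWW bound2 ind
  refine (abs_add_le _ _).trans (add_le_add (abs_add_three _ _ _) le_rfl |>.trans ?_)
  linarith

theorem pre_sub (k : Fin N) : pre φ θ x s k - pre φ θ x' s' k = pre φ θ (x - x') (s - s') k := by
  simp only [pre, Pi.sub_apply, mul_sub, Finset.sum_sub_distrib]
  ring

theorem preA_sub (i : Fin N) (j : Fin d) (k : Fin N) :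
    preA φ θ x s₁ i j k - preA φ θ x' s₁' i j k = preA φ θ (x - x') (s₁ - s₁') i j k := by
  simp only [preA, Pi.sub_apply, Prod.fst_sub, mul_sub, Finset.sum_sub_distrib]
  ring

theorem preW_sub (i j k : Fin N) :
    preW φ θ s s₁ i j k - preW φ θ s' s₁' i j k = preW φ θ (s - s') (s₁ - s₁') i j k := by
  simp only [preW, Pi.sub_apply, Prod.snd_sub, mul_sub, Finset.sum_sub_distrib]
  ring

theorem preAA_sub (n : Fin N) (m : Fin d) (i : Fin N) (j : Fin d) (k : Fin N) :
    preAA φ θ x s₂ n m i j k - preAA φ θ x' s₂' n m i j k =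
      preAA φ θ (x - x') (s₂ - s₂') n m i j k := by
  simp only [preAA, Pi.sub_apply, Prod.fst_sub, mul_sub, Finset.sum_sub_distrib]
  ring

theorem preWA_sub (n m i : Fin N) (j : Fin d) (k : Fin N) :
    preWA φ θ s₁ s₂ n m i j k - preWA φ θ s₁' s₂' n m i j k =
      preWA φ θ (s₁ - s₁') (s₂ - s₂') n m i j k := by
  simp only [preWA, Pi.sub_apply, Prod.fst_sub, Prod.snd_sub, mul_sub, Finset.sum_sub_distrib]
  ring

theorem preWW_sub (n m i j k : Fin N) :
    preWW φ θ s s₁ s₂ n m i j k - preWW φ θ s' s₁' s₂' n m i j k =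
      preWW φ θ (s - s') (s₁ - s₁') (s₂ - s₂') n m i j k := by
  simp only [preWW, Pi.sub_apply, Prod.snd_sub, mul_sub, Finset.sum_sub_distrib]
  ring

end Step

section StepBounds

theorem abs_mul_sub_mul_le {f a f' a' F α M P : ℝ} (hf : |f| ≤ F) (ha : |a - a'| ≤ α)
    (hf' : |f - f'| ≤ P) (ha' : |a'| ≤ M) : |f * a - f' * a'| ≤ F * α + P * M := by
  have e : f * a - f' * a' = f * (a - a') + (f - f') * a' := by ring
  rw [e]
  refine (abs_add_le _ _).trans ?_
  rw [abs_mul, abs_mul]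
  exact add_le_add (mul_le_mul hf ha (abs_nonneg _) ((abs_nonneg _).trans hf))
    (mul_le_mul hf' ha' (abs_nonneg _) ((abs_nonneg _).trans hf'))

/-- The increment of an entry of the first derivatives of the hidden state. -/
theorem abs_first_sub_le {p p' a a' α M P : ℝ} (hp : |p - p'| ≤ P) (ha : |a - a'| ≤ α)
    (ha' : |a'| ≤ M) :
    |deriv Real.sigmoid p * a - deriv Real.sigmoid p' * a'| ≤ 1 / 4 * α + P * M :=
  abs_mul_sub_mul_le (abs_deriv_sigmoid_le p) ha ((abs_deriv_sigmoid_sub_le _ _).trans hp) ha'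

/-- The increment of an entry of the second derivatives of the hidden state. -/
theorem abs_second_sub_le {p p' a a' b b' e e' α β M M₂ P : ℝ} (hp : |p - p'| ≤ P)
    (ha : |a - a'| ≤ α) (hb : |b - b'| ≤ α) (he : |e - e'| ≤ β) (ha₀ : |a| ≤ M) (ha' : |a'| ≤ M)
    (hb' : |b'| ≤ M) (he' : |e'| ≤ M₂) :
    |(deriv (deriv Real.sigmoid) p * a * b + deriv Real.sigmoid p * e) -
        (deriv (deriv Real.sigmoid) p' * a' * b' + deriv Real.sigmoid p' * e')| ≤
      (1 * M * α + (1 * α + P * M) * M) + (1 / 4 * β + P * M₂) := by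
  have h1 : |deriv (deriv Real.sigmoid) p * a - deriv (deriv Real.sigmoid) p' * a'| ≤
      1 * α + P * M :=
    abs_mul_sub_mul_le (abs_deriv_deriv_sigmoid_le p) ha
      ((abs_deriv_deriv_sigmoid_sub_le _ _).trans hp) ha'
  have h0 : |deriv (deriv Real.sigmoid) p * a| ≤ 1 * M := by
    rw [abs_mul]
    exact mul_le_mul (abs_deriv_deriv_sigmoid_le p) ha₀ (abs_nonneg _) zero_le_one
  have h2 := abs_mul_sub_mul_le h0 hb h1 hb'
  have h3 := abs_first_sub_le hp he he'
  rw [add_sub_add_comm]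
  exact (abs_add_le _ _).trans (add_le_add h2 h3)

theorem abs_second_le {p a b e M M₂ : ℝ} (ha : |a| ≤ M) (hb : |b| ≤ M) (he : |e| ≤ M₂) :
    |deriv (deriv Real.sigmoid) p * a * b + deriv Real.sigmoid p * e| ≤ M ^ 2 + 1 / 4 * M₂ := by
  refine (abs_add_le _ _).trans (add_le_add ?_ ?_)
  · rw [abs_mul, abs_mul, mul_assoc, ← one_mul (M ^ 2), pow_two]
    exact mul_le_mul (abs_deriv_deriv_sigmoid_le p)
      (mul_le_mul ha hb (abs_nonneg _) ((abs_nonneg _).trans ha)) (by positivity) zero_le_one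
  · rw [abs_mul]
    exact mul_le_mul (abs_deriv_sigmoid_le p) he (abs_nonneg _) (by norm_num)

variable {d dZ N : ℕ} {φ : ℝ → ℝ} (θ : Params d N) {C C₁ C₂ : ℝ} (hφ₀ : ∀ y, |φ y| ≤ C)
  (hφ₁ : ∀ y, |deriv φ y| ≤ C₁) (hφ₂ : ∀ y, |deriv (deriv φ) y| ≤ C₂)
variable (x x' : Fin d → ℝ) (s s' : Fin N → ℝ) (s₁ s₁' : FirstDeriv d N)
  (s₂ s₂' : SecondDeriv d N)

theorem norm_stepS_le : ‖stepS φ θ x s‖ ≤ 1 :=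
  (pi_norm_le_iff_of_nonneg zero_le_one).2 fun k => by
    rw [stepS, Real.norm_eq_abs, abs_of_nonneg (Real.sigmoid_nonneg _)]
    exact Real.sigmoid_le_one _

include hφ₀ hφ₁ in
theorem norm_stepFirst_le {M : ℝ} (hM : bound1 C C₁ ‖x‖ ‖s‖ ‖s₁‖ ≤ M) :
    ‖stepFirst φ θ x s s₁‖ ≤ 1 / 4 * M := by
  have hM0 : 0 ≤ M := by
    have hC : 0 ≤ C := (abs_nonneg _).trans (hφ₀ 0)
    have hC₁ : 0 ≤ C₁ := (abs_nonneg _).trans (hφ₁ 0)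
    refine le_trans ?_ hM
    unfold bound1; positivity
  refine norm_prod_le_iff.2 ⟨?_, ?_⟩ <;>
    refine (pi_norm_le_iff_of_nonneg (by positivity)).2 ?_ <;> rintro ⟨i, j, k⟩ <;>
    simp only [stepFirst, Real.norm_eq_abs, abs_mul] <;>
    refine mul_le_mul (abs_deriv_sigmoid_le _) (le_trans ?_ hM) (abs_nonneg _) (by norm_num)
  · exact abs_preA_le θ hφ₀ hφ₁ x s s₁ i j k
  · exact abs_preW_le θ hφ₀ hφ₁ x s s₁ i j k

include hφ₀ hφ₁ hφ₂ in
theorem norm_stepSecond_le {M M₂ : ℝ} (hM : bound1 C C₁ ‖x‖ ‖s‖ ‖s₁‖ ≤ M)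
    (hM₂ : bound2 C C₁ C₂ ‖x‖ ‖s‖ ‖s₁‖ ‖s₂‖ ≤ M₂) :
    ‖stepSecond φ θ x s s₁ s₂‖ ≤ M ^ 2 + 1 / 4 * M₂ := by
  have hM0 : 0 ≤ M₂ := by
    have hC : 0 ≤ C := (abs_nonneg _).trans (hφ₀ 0)
    have hC₁ : 0 ≤ C₁ := (abs_nonneg _).trans (hφ₁ 0)
    have hC₂ : 0 ≤ C₂ := (abs_nonneg _).trans (hφ₂ 0)
    refine le_trans ?_ hM₂
    unfold bound2; positivity
  have hA := fun i j k => (abs_preA_le θ hφ₀ hφ₁ x s s₁ i j k).trans hM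
  have hW := fun i j k => (abs_preW_le θ hφ₀ hφ₁ x s s₁ i j k).trans hM
  refine norm_prod_le_iff.2 ⟨?_, norm_prod_le_iff.2 ⟨?_, ?_⟩⟩ <;>
    refine (pi_norm_le_iff_of_nonneg (by positivity)).2 ?_ <;> rintro ⟨n, m, i, j, k⟩
  · exact abs_second_le (hA _ _ _) (hA _ _ _)
      ((abs_preAA_le θ hφ₀ hφ₁ hφ₂ x s s₁ s₂ n m i j k).trans hM₂)
  · exact abs_second_le (hW _ _ _) (hA _ _ _)
      ((abs_preWA_le θ hφ₀ hφ₁ hφ₂ x s s₁ s₂ n m i j k).trans hM₂)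
  · exact abs_second_le (hW _ _ _) (hW _ _ _)
      ((abs_preWW_le θ hφ₀ hφ₁ hφ₂ x s s₁ s₂ n m i j k).trans hM₂)

include hφ₀ in
theorem abs_pre_sub_le (k : Fin N) :
    |pre φ θ x s k - pre φ θ x' s' k| ≤ C * (‖x - x'‖ + ‖s - s'‖) := by
  rw [pre_sub]; exact abs_pre_le θ hφ₀ _ _ k

include hφ₀ in
theorem norm_stepS_sub_le :
    ‖stepS φ θ x s - stepS φ θ x' s'‖ ≤ 1 / 4 * (C * (‖x - x'‖ + ‖s - s'‖)) := by
  have hC : 0 ≤ C := (abs_nonneg _).trans (hφ₀ 0)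
  refine (pi_norm_le_iff_of_nonneg (by positivity)).2 fun k => ?_
  refine (abs_sigmoid_sub_le _ _).trans ?_
  gcongr
  exact abs_pre_sub_le θ hφ₀ x x' s s' k

include hφ₀ hφ₁ in
theorem norm_stepFirst_sub_le {M : ℝ} (hM : bound1 C C₁ ‖x'‖ ‖s'‖ ‖s₁'‖ ≤ M) :
    ‖stepFirst φ θ x s s₁ - stepFirst φ θ x' s' s₁'‖ ≤
      1 / 4 * bound1 C C₁ ‖x - x'‖ ‖s - s'‖ ‖s₁ - s₁'‖ + C * (‖x - x'‖ + ‖s - s'‖) * M := by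
  have hC : 0 ≤ C := (abs_nonneg _).trans (hφ₀ 0)
  have hC₁ : 0 ≤ C₁ := (abs_nonneg _).trans (hφ₁ 0)
  have hb : ∀ {X S S₁ : ℝ}, 0 ≤ X → 0 ≤ S → 0 ≤ S₁ → 0 ≤ bound1 C C₁ X S S₁ := by
    intro X S S₁ h1 h2 h3; unfold bound1; positivity
  have h0 := hb (norm_nonneg (x - x')) (norm_nonneg (s - s')) (norm_nonneg (s₁ - s₁'))
  have hM0 : 0 ≤ M := (hb (norm_nonneg _) (norm_nonneg _) (norm_nonneg _)).trans hM
  refine norm_prod_le_iff.2 ⟨?_, ?_⟩ <;>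
    refine (pi_norm_le_iff_of_nonneg (by positivity)).2 ?_ <;> rintro ⟨i, j, k⟩
  · refine abs_first_sub_le (abs_pre_sub_le θ hφ₀ x x' s s' k) ?_
      ((abs_preA_le θ hφ₀ hφ₁ x' s' s₁' i j k).trans hM)
    rw [preA_sub]; exact abs_preA_le θ hφ₀ hφ₁ _ _ _ i j k
  · refine abs_first_sub_le (abs_pre_sub_le θ hφ₀ x x' s s' k) ?_
      ((abs_preW_le θ hφ₀ hφ₁ x' s' s₁' i j k).trans hM)
    rw [preW_sub]; exact abs_preW_le θ hφ₀ hφ₁ _ _ _ i j k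

include hφ₀ hφ₁ hφ₂ in
theorem norm_stepSecond_sub_le {M M₂ : ℝ} (hM : bound1 C C₁ ‖x‖ ‖s‖ ‖s₁‖ ≤ M)
    (hM' : bound1 C C₁ ‖x'‖ ‖s'‖ ‖s₁'‖ ≤ M) (hM₂ : bound2 C C₁ C₂ ‖x'‖ ‖s'‖ ‖s₁'‖ ‖s₂'‖ ≤ M₂) :
    ‖stepSecond φ θ x s s₁ s₂ - stepSecond φ θ x' s' s₁' s₂'‖ ≤
      (1 * M * bound1 C C₁ ‖x - x'‖ ‖s - s'‖ ‖s₁ - s₁'‖ +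
        (1 * bound1 C C₁ ‖x - x'‖ ‖s - s'‖ ‖s₁ - s₁'‖ + C * (‖x - x'‖ + ‖s - s'‖) * M) * M) +
      (1 / 4 * bound2 C C₁ C₂ ‖x - x'‖ ‖s - s'‖ ‖s₁ - s₁'‖ ‖s₂ - s₂'‖ +
        C * (‖x - x'‖ + ‖s - s'‖) * M₂) := by
  have hC : 0 ≤ C := (abs_nonneg _).trans (hφ₀ 0)
  have hC₁ : 0 ≤ C₁ := (abs_nonneg _).trans (hφ₁ 0)
  have hC₂ : 0 ≤ C₂ := (abs_nonneg _).trans (hφ₂ 0)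
  have hb : ∀ {X S S₁ : ℝ}, 0 ≤ X → 0 ≤ S → 0 ≤ S₁ → 0 ≤ bound1 C C₁ X S S₁ := by
    intro X S S₁ h1 h2 h3; unfold bound1; positivity
  have hb₂ : ∀ {X S S₁ S₂ : ℝ}, 0 ≤ X → 0 ≤ S → 0 ≤ S₁ → 0 ≤ S₂ →
      0 ≤ bound2 C C₁ C₂ X S S₁ S₂ := by
    intro X S S₁ S₂ h1 h2 h3 h4; unfold bound2; positivity
  have h0 := hb (norm_nonneg (x - x')) (norm_nonneg (s - s')) (norm_nonneg (s₁ - s₁'))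
  have h02 := hb₂ (norm_nonneg (x - x')) (norm_nonneg (s - s')) (norm_nonneg (s₁ - s₁'))
    (norm_nonneg (s₂ - s₂'))
  have hM0 : 0 ≤ M := (hb (norm_nonneg _) (norm_nonneg _) (norm_nonneg _)).trans hM
  have hM20 : 0 ≤ M₂ :=
    (hb₂ (norm_nonneg _) (norm_nonneg _) (norm_nonneg _) (norm_nonneg _)).trans hM₂
  have hp := abs_pre_sub_le θ hφ₀ x x' s s'
  have hA := fun i j k => (abs_preA_le θ hφ₀ hφ₁ x s s₁ i j k).trans hM
  have hW := fun i j k => (abs_preW_le θ hφ₀ hφ₁ x s s₁ i j k).trans hM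
  have hA' := fun i j k => (abs_preA_le θ hφ₀ hφ₁ x' s' s₁' i j k).trans hM'
  have hW' := fun i j k => (abs_preW_le θ hφ₀ hφ₁ x' s' s₁' i j k).trans hM'
  have hdA := fun i j k => (preA_sub θ x x' s₁ s₁' i j k (φ := φ)).symm ▸
    abs_preA_le θ hφ₀ hφ₁ (x - x') (s - s') (s₁ - s₁') i j k
  have hdW := fun i j k => (preW_sub θ s s' s₁ s₁' i j k (φ := φ)).symm ▸
    abs_preW_le θ hφ₀ hφ₁ (x - x') (s - s') (s₁ - s₁') i j k
  refine norm_prod_le_iff.2 ⟨?_, norm_prod_le_iff.2 ⟨?_, ?_⟩⟩ <;>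
    refine (pi_norm_le_iff_of_nonneg (by positivity)).2 ?_ <;> rintro ⟨n, m, i, j, k⟩
  · refine abs_second_sub_le (hp k) (hdA _ _ _) (hdA _ _ _) ?_ (hA _ _ _) (hA' _ _ _) (hA' _ _ _)
      ((abs_preAA_le θ hφ₀ hφ₁ hφ₂ x' s' s₁' s₂' n m i j k).trans hM₂)
    rw [preAA_sub]; exact abs_preAA_le θ hφ₀ hφ₁ hφ₂ _ _ _ _ n m i j k
  · refine abs_second_sub_le (hp k) (hdW _ _ _) (hdA _ _ _) ?_ (hW _ _ _) (hW' _ _ _) (hA' _ _ _)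
      ((abs_preWA_le θ hφ₀ hφ₁ hφ₂ x' s' s₁' s₂' n m i j k).trans hM₂)
    rw [preWA_sub]; exact abs_preWA_le θ hφ₀ hφ₁ hφ₂ _ _ _ _ n m i j k
  · refine abs_second_sub_le (hp k) (hdW _ _ _) (hdW _ _ _) ?_ (hW _ _ _) (hW' _ _ _) (hW' _ _ _)
      ((abs_preWW_le θ hφ₀ hφ₁ hφ₂ x' s' s₁' s₂' n m i j k).trans hM₂)
    rw [preWW_sub]; exact abs_preWW_le θ hφ₀ hφ₁ hφ₂ _ _ _ _ n m i j k

end StepBounds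

/-! ### A region and a norm in which the hidden state contracts -/

section Region

variable {d dZ N : ℕ}

/-- The hidden states whose three layers of derivatives are bounded by `k₀`, `k₁` and `k₂`. -/
def box (d N : ℕ) (k₀ k₁ k₂ : ℝ) : Set (Hidden d N) :=
  {v | ‖v.1‖ ≤ k₀ ∧ ‖v.2.1‖ ≤ k₁ ∧ ‖v.2.2‖ ≤ k₂}

/-- The weighted norm `‖s‖ + a₁ ‖s'‖ + a₂ ‖s''‖` of `v = (s, s', s'')`. -/
def wnorm (a₁ a₂ : ℝ) (v : Hidden d N) : ℝ := ‖v.1‖ + a₁ * ‖v.2.1‖ + a₂ * ‖v.2.2‖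

theorem isClosed_box (k₀ k₁ k₂ : ℝ) : IsClosed (box d N k₀ k₁ k₂) :=
  (isClosed_le (f := fun v : Hidden d N => ‖v.1‖) (by fun_prop) continuous_const).inter
    ((isClosed_le (f := fun v : Hidden d N => ‖v.2.1‖) (by fun_prop) continuous_const).inter
      (isClosed_le (f := fun v : Hidden d N => ‖v.2.2‖) (by fun_prop) continuous_const))

theorem continuous_wnorm (a₁ a₂ : ℝ) : Continuous (wnorm (d := d) (N := N) a₁ a₂) := by
  unfold wnorm; fun_prop

/-- The arithmetic of a triangular system of increments: each layer `f₀`, `f₁`, `f₂` contracts by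
`C / 4` and depends on the previous ones with constants `b₁`, `b₂`; small weights `a₁`, `a₂` turn
this into a contraction by `C / 2`. -/
theorem weighted_increment_le {C a₁ a₂ b₁ b₂ δ D e₀ e₁ e₂ f₀ f₁ f₂ : ℝ} (hC : 0 ≤ C)
    (ha₁ : 0 ≤ a₁) (ha₂ : 0 ≤ a₂) (ha₁1 : a₁ ≤ 1) (hab₁ : a₁ * b₁ + a₁ = C / 8)
    (hab₂ : a₂ * b₂ + a₂ = C / 8 * a₁) (hδ : 0 ≤ δ) (he₀ : 0 ≤ e₀) (he₁ : 0 ≤ e₁) (he₂ : 0 ≤ e₂)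
    (hD : δ ≤ D) (hf₀ : f₀ ≤ C / 4 * (δ + e₀)) (hf₁ : f₁ ≤ C / 4 * e₁ + b₁ * (δ + e₀))
    (hf₂ : f₂ ≤ C / 4 * e₂ + b₂ * (δ + e₀ + e₁)) :
    f₀ + a₁ * f₁ + a₂ * f₂ ≤ C / 2 * (D + (e₀ + a₁ * e₁ + a₂ * e₂)) := by
  have g1 : a₁ * f₁ ≤ C / 4 * (a₁ * e₁) + C / 8 * (δ + e₀) := by
    have p2 : 0 ≤ a₁ * (δ + e₀) := by positivity
    calc a₁ * f₁ ≤ a₁ * (C / 4 * e₁ + b₁ * (δ + e₀)) := by gcongr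
      _ = C / 4 * (a₁ * e₁) + (a₁ * b₁ + a₁) * (δ + e₀) - a₁ * (δ + e₀) := by ring
      _ ≤ _ := by rw [hab₁]; linarith
  have g2 : a₂ * f₂ ≤ C / 4 * (a₂ * e₂) + C / 8 * (δ + e₀) + C / 8 * (a₁ * e₁) := by
    have p2 : 0 ≤ a₂ * (δ + e₀ + e₁) := by positivity
    have p4 : C / 8 * a₁ * (δ + e₀) ≤ C / 8 * 1 * (δ + e₀) := by gcongr
    calc a₂ * f₂ ≤ a₂ * (C / 4 * e₂ + b₂ * (δ + e₀ + e₁)) := by gcongr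
      _ = C / 4 * (a₂ * e₂) + (a₂ * b₂ + a₂) * (δ + e₀ + e₁) - a₂ * (δ + e₀ + e₁) := by ring
      _ ≤ _ := by rw [hab₂]; linarith
  have p5 : 0 ≤ C * (a₁ * e₁) := by positivity
  have p6 : 0 ≤ C * (a₂ * e₂) := by positivity
  have p7 : C * δ ≤ C * D := by gcongr
  linarith

/-- A region stable under the recursion, and a weighted norm in which the recursion contracts there.
Box and weights depend on `K` but not on `θ`, which makes the final constant uniform in `θ`. -/
theorem exists_box_contraction {φ : ℝ → ℝ} {C C₁ C₂ : ℝ} (hC : 0 < C) (hC1 : C < 1)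
    (hφ₀ : ∀ y, |φ y| ≤ C) (hφ₁ : ∀ y, |deriv φ y| ≤ C₁) (hφ₂ : ∀ y, |deriv (deriv φ) y| ≤ C₂)
    {K : ℝ} (hK : 0 ≤ K) :
    ∃ k₀ k₁ k₂ a₁ a₂ : ℝ, K ≤ k₀ ∧ K ≤ k₁ ∧ K ≤ k₂ ∧ 0 < a₁ ∧ 0 < a₂ ∧ ∀ θ : Params d N,
      (∀ (u : Data d dZ), ‖u‖ ≤ 1 → ∀ v ∈ box d N k₀ k₁ k₂, step φ θ (u, v) ∈ box d N k₀ k₁ k₂) ∧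
      ∀ (u u' : Data d dZ), ‖u‖ ≤ 1 → ‖u'‖ ≤ 1 →
        ∀ v ∈ box d N k₀ k₁ k₂, ∀ v' ∈ box d N k₀ k₁ k₂,
        wnorm a₁ a₂ (step φ θ (u, v) - step φ θ (u', v')) ≤
          C / 2 * (‖u - u'‖ + wnorm a₁ a₂ (v - v')) := by
  have hC₁ : 0 ≤ C₁ := (abs_nonneg _).trans (hφ₁ 0)
  have hC₂ : 0 ≤ C₂ := (abs_nonneg _).trans (hφ₂ 0)
  obtain ⟨k₀, hk₀⟩ : ∃ k₀, k₀ = 1 + K := ⟨_, rfl⟩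
  obtain ⟨k₁, hk₁⟩ : ∃ k₁, k₁ = K + C₁ * (1 + k₀) := ⟨_, rfl⟩
  obtain ⟨M, hM⟩ : ∃ M, M = C₁ * (1 + k₀) + k₁ := ⟨_, rfl⟩
  obtain ⟨k₂, hk₂⟩ : ∃ k₂, k₂ = K + 2 * (M ^ 2 + C₂ * (1 + k₀) + 2 * C₁ * k₁) := ⟨_, rfl⟩
  obtain ⟨M₂, hM₂⟩ : ∃ M₂, M₂ = C₂ * (1 + k₀) + 2 * C₁ * k₁ + k₂ := ⟨_, rfl⟩
  have hk₀0 : 0 ≤ k₀ := by rw [hk₀]; positivity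
  have hk₁0 : 0 ≤ k₁ := by rw [hk₁]; positivity
  have hM0 : 0 ≤ M := by rw [hM]; positivity
  have hk₂0 : 0 ≤ k₂ := by rw [hk₂]; positivity
  have hM₂0 : 0 ≤ M₂ := by rw [hM₂]; positivity
  obtain ⟨b₁, hb₁⟩ : ∃ b₁, b₁ = C₁ / 4 + C * M := ⟨_, rfl⟩
  obtain ⟨b₂, hb₂⟩ : ∃ b₂, b₂ = (2 * M * C₁ + M ^ 2 * C + C₂ / 4 + C * M₂) +
    (2 * M * C + C₁ / 2) := ⟨_, rfl⟩
  have hb₁0 : 0 ≤ b₁ := by rw [hb₁]; positivity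
  have hb₂0 : 0 ≤ b₂ := by rw [hb₂]; positivity
  -- The weights are small enough for the influence of each layer on the next one to be absorbed.
  obtain ⟨a₁, ha₁⟩ : ∃ a₁, a₁ = C / 8 / (b₁ + 1) := ⟨_, rfl⟩
  obtain ⟨a₂, ha₂⟩ : ∃ a₂, a₂ = C / 8 * a₁ / (b₂ + 1) := ⟨_, rfl⟩
  have ha₁0 : 0 < a₁ := by rw [ha₁]; positivity
  have ha₂0 : 0 < a₂ := by rw [ha₂]; positivity
  have hab₁ : a₁ * b₁ + a₁ = C / 8 := by rw [ha₁]; field_simp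
  have hab₂ : a₂ * b₂ + a₂ = C / 8 * a₁ := by rw [ha₂]; field_simp
  have ha₁1 : a₁ ≤ 1 := by nlinarith
  have hx : ∀ u : Data d dZ, ‖u‖ ≤ 1 → ‖u.1‖ ≤ 1 := fun u hu => (norm_fst_le u).trans hu
  have hbd1 : ∀ (u : Data d dZ), ‖u‖ ≤ 1 → ∀ v ∈ box d N k₀ k₁ k₂,
      bound1 C C₁ ‖u.1‖ ‖v.1‖ ‖v.2.1‖ ≤ M := by
    intro u hu v hv
    rw [hM, bound1]
    gcongr
    · exact hx u hu
    · exact hv.1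
    · exact (mul_le_of_le_one_left (norm_nonneg _) hC1.le).trans hv.2.1
  have hbd2 : ∀ (u : Data d dZ), ‖u‖ ≤ 1 → ∀ v ∈ box d N k₀ k₁ k₂,
      bound2 C C₁ C₂ ‖u.1‖ ‖v.1‖ ‖v.2.1‖ ‖v.2.2‖ ≤ M₂ := by
    intro u hu v hv
    rw [hM₂, bound2]
    gcongr
    · exact hx u hu
    · exact hv.1
    · exact hv.2.1
    · exact (mul_le_of_le_one_left (norm_nonneg _) hC1.le).trans hv.2.2
  refine ⟨k₀, k₁, k₂, a₁, a₂, by linarith, ?_, ?_, ha₁0, ha₂0, fun θ => ⟨?_, ?_⟩⟩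
  · rw [hk₁]; exact le_add_of_nonneg_right (by positivity)
  · rw [hk₂]; exact le_add_of_nonneg_right (by positivity)
  · intro u hu v hv
    refine ⟨(norm_stepS_le θ u.1 v.1).trans (by linarith), ?_, ?_⟩
    · refine (norm_stepFirst_le θ hφ₀ hφ₁ u.1 v.1 v.2.1 (hbd1 u hu v hv)).trans ?_
      linarith
    · refine (norm_stepSecond_le θ hφ₀ hφ₁ hφ₂ u.1 v.1 v.2.1 v.2.2 (hbd1 u hu v hv)
        (hbd2 u hu v hv)).trans ?_
      have h1 : 0 ≤ C₂ * (1 + k₀) := by positivity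
      have h2 : 0 ≤ C₁ * k₁ := by positivity
      nlinarith [sq_nonneg M]
  · intro u u' hu hu' v hv v' hv'
    have h0 := norm_stepS_sub_le θ hφ₀ u.1 u'.1 v.1 v'.1
    have h1 := norm_stepFirst_sub_le θ hφ₀ hφ₁ u.1 u'.1 v.1 v'.1 v.2.1 v'.2.1 (hbd1 u' hu' v' hv')
    have h2 := norm_stepSecond_sub_le θ hφ₀ hφ₁ hφ₂ u.1 u'.1 v.1 v'.1 v.2.1 v'.2.1 v.2.2 v'.2.2
      (hbd1 u hu v hv) (hbd1 u' hu' v' hv') (hbd2 u' hu' v' hv')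
    have hD : ‖u.1 - u'.1‖ ≤ ‖u - u'‖ := norm_fst_le (u - u')
    have hδ := norm_nonneg (u.1 - u'.1)
    change ‖stepS φ θ u.1 v.1 - stepS φ θ u'.1 v'.1‖ +
      a₁ * ‖stepFirst φ θ u.1 v.1 v.2.1 - stepFirst φ θ u'.1 v'.1 v'.2.1‖ +
      a₂ * ‖stepSecond φ θ u.1 v.1 v.2.1 v.2.2 - stepSecond φ θ u'.1 v'.1 v'.2.1 v'.2.2‖ ≤
      C / 2 * (‖u - u'‖ + (‖v.1 - v'.1‖ + a₁ * ‖v.2.1 - v'.2.1‖ + a₂ * ‖v.2.2 - v'.2.2‖))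
    simp only [bound1, bound2] at h1 h2
    have n0 := norm_nonneg (v.1 - v'.1)
    have n1 := norm_nonneg (v.2.1 - v'.2.1)
    have n2 := norm_nonneg (v.2.2 - v'.2.2)
    generalize ‖u.1 - u'.1‖ = δ at *
    generalize ‖u - u'‖ = D at *
    generalize ‖v.1 - v'.1‖ = e₀ at *
    generalize ‖v.2.1 - v'.2.1‖ = e₁ at *
    generalize ‖v.2.2 - v'.2.2‖ = e₂ at *
    generalize ‖stepS φ θ u.1 v.1 - stepS φ θ u'.1 v'.1‖ = f₀ at *
    generalize ‖stepFirst φ θ u.1 v.1 v.2.1 - stepFirst φ θ u'.1 v'.1 v'.2.1‖ = f₁ at *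
    generalize ‖stepSecond φ θ u.1 v.1 v.2.1 v.2.2 -
      stepSecond φ θ u'.1 v'.1 v'.2.1 v'.2.2‖ = f₂ at *
    have g1 : f₁ ≤ C / 4 * e₁ + b₁ * (δ + e₀) := by rw [hb₁]; linarith
    have g2 : f₂ ≤ C / 4 * e₂ + b₂ * (δ + e₀ + e₁) := by
      have q1 : 0 ≤ (2 * M * C + C₁ / 2) * (δ + e₀) := by positivity
      have q2 : 0 ≤ (2 * M * C₁ + M ^ 2 * C + C₂ / 4 + C * M₂) * e₁ := by positivity
      rw [hb₂]; linarith
    exact weighted_increment_le hC.le ha₁0.le ha₂0.le ha₁1 hab₁ hab₂ hδ n0 n1 n2 hD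
      (h0.trans_eq (by ring)) g1 g2

end Region

/-! ### The data chain -/

section DataChain

theorem wass_self_le {X : Type*} [NormedAddCommGroup X] [MeasurableSpace X] [BorelSpace X]
    [SecondCountableTopology X] (μ : Measure X) {b : ℝ} : wass 2 μ μ ≤ ENNReal.ofReal b := by
  have hm : Measurable fun x : X => (x, x) := by fun_prop
  have hc : IsCoupling (μ.map fun x => (x, x)) μ μ := by
    constructor <;> rw [Measure.map_map (by fun_prop) hm] <;> exact Measure.map_id
  refine (wass_two_le_of_isCoupling hc (B := 0) ?_).trans (by simp)
  rw [lintegral_map (by fun_prop) hm]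
  simp

variable {d dZ : ℕ} {κ : Kernel (Data d dZ) (Data d dZ)}

/-- The starting points from which the data chain stays in the unit box almost surely. -/
def goodData (κ : Kernel (Data d dZ) (Data d dZ)) : Set (Data d dZ) :=
  {u | ∀ n : ℕ, (κ ^ n) u {w | ‖w‖ ≤ 1}ᶜ = 0}

theorem measurableSet_norm_le_one : MeasurableSet {w : Data d dZ | ‖w‖ ≤ 1} :=
  measurableSet_le (by fun_prop) (by fun_prop)

theorem measurableSet_goodData : MeasurableSet (goodData κ) := by
  rw [goodData, Set.ofPred_forall]
  exact .iInter fun n => (Kernel.measurable_coe _ measurableSet_norm_le_one.compl)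
    (measurableSet_singleton 0)

theorem lawAt_dirac {X : Type*} [MeasurableSpace X] (P : Kernel X X) (x : X) (n : ℕ) :
    lawAt P (Measure.dirac x) n = (P ^ n) x :=
  Measure.dirac_bind (Kernel.measurable _) x

theorem staysInUnitBox_dirac {u : Data d dZ} (hu : u ∈ goodData κ) :
    StaysInUnitBox κ (Measure.dirac u) := fun n => by
  rw [lawAt_dirac]; exact hu n

theorem norm_le_one_of_mem_goodData {u : Data d dZ} (hu : u ∈ goodData κ) : ‖u‖ ≤ 1 := by
  have h := staysInUnitBox_dirac hu 0
  rw [lawAt_zero, ae_dirac_iff measurableSet_norm_le_one] at h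
  exact h

theorem ae_mem_goodData {ρ : Measure (Data d dZ)} (h : StaysInUnitBox κ ρ) :
    ∀ᵐ u ∂ρ, u ∈ goodData κ :=
  ae_all_iff.2 fun n => Measure.ae_ae_of_ae_comp (h n)

theorem ae_kernel_mem_goodData {u : Data d dZ} (hu : u ∈ goodData κ) :
    ∀ᵐ w ∂(κ u), w ∈ goodData κ := by
  refine ae_mem_goodData fun n => ?_
  have h := staysInUnitBox_dirac hu (n + 1)
  rwa [lawAt_succ', Measure.dirac_bind κ.measurable] at h

variable [IsMarkovKernel κ] {L : ℝ≥0}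

theorem lipschitzWith_integral_pow (hL : 0 < L)
    (hκ : ∀ u u', wass 2 (κ u) (κ u') ≤ L * ENNReal.ofReal ‖u - u'‖) {f : Data d dZ → ℝ}
    (hf : LipschitzWith 1 f) (hf1 : ∀ u, |f u| ≤ 1) (n : ℕ) :
    LipschitzWith (L ^ n) fun u => ∫ w, f w ∂((κ ^ n) u) := by
  have hint : ∀ (m : Measure (Data d dZ)) [IsProbabilityMeasure m], Integrable f m := fun m _ =>
    Integrable.of_bound hf.continuous.measurable.aestronglyMeasurable 1 (.of_forall hf1)
  have hprob : ∀ n u, IsProbabilityMeasure ((κ ^ n) u) := fun n u => by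
    rw [← lawAt_dirac]; exact isProbabilityMeasure_lawAt κ _ n
  induction n with
  | zero =>
    have : ∀ u, ∫ w, f w ∂((κ ^ 0) u) = f u := fun u => by
      rw [← lawAt_dirac, lawAt_zero, integral_dirac]
    simp_rw [this]
    rwa [pow_zero]
  | succ n ih =>
    have hbd : ∀ u, |∫ w, f w ∂((κ ^ n) u)| ≤ 1 := fun u => by
      have := norm_integral_le_of_norm_le_const (μ := (κ ^ n) u) (f := f) (C := 1) (.of_forall hf1)
      have h1 := hprob n u
      simpa using this
    have hstep : ∀ u, ∫ w, f w ∂((κ ^ (n + 1)) u) = ∫ x, ∫ w, f w ∂((κ ^ n) x) ∂(κ u) := by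
      intro u
      have h1 := hprob (n + 1) u
      have e : κ ^ (n + 1) = (κ ^ n) ∘ₖ κ := pow_succ κ n
      rw [e] at h1 ⊢
      exact Kernel.integral_comp (hint _)
    intro u u'
    simp only [hstep]
    rw [edist_dist, Real.dist_eq]
    refine (abs_integral_sub_le_wass (pow_pos hL n) ih hbd).trans ?_
    rw [edist_eq_enorm_sub, ← ofReal_norm, pow_succ, ENNReal.coe_mul, mul_assoc]
    gcongr
    exact hκ u u'

/-- If one starting point is good, every invariant law of a contracting data chain lives on the
good points: the mean distance to the unit box, capped at `1`, contracts along the chain. -/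
theorem staysInUnitBox_of_invariant (hL : 0 < L) (hL1 : L < 1)
    (hκ : ∀ u u', wass 2 (κ u) (κ u') ≤ L * ENNReal.ofReal ‖u - u'‖) {u₀ : Data d dZ}
    (hu₀ : u₀ ∈ goodData κ) {m : Measure (Data d dZ)} [IsProbabilityMeasure m]
    (hm : Kernel.Invariant κ m) : StaysInUnitBox κ m := by
  intro t
  rw [lawAt_of_invariant hm]
  let f : Data d dZ → ℝ := fun u => min (max (‖u‖ - 1) 0) 1
  have hf0 : ∀ u, 0 ≤ f u := fun u => le_min (le_max_right _ _) zero_le_one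
  have hfle : ∀ u, f u ≤ 1 := fun u => min_le_right _ _
  have hf1 : ∀ u, |f u| ≤ 1 := fun u => by rw [abs_of_nonneg (hf0 u)]; exact hfle u
  have hfL : LipschitzWith 1 f := by
    have h1 : LipschitzWith 1 fun u : Data d dZ => ‖u‖ - 1 :=
      .of_dist_le_mul fun x y => by
        rw [Real.dist_eq, dist_eq_norm, sub_sub_sub_cancel_right, NNReal.coe_one, one_mul]
        exact abs_norm_sub_norm_le x y
    exact (h1.max_const 0).min_const 1
  have hfm : Measurable fun u => ENNReal.ofReal (f u) := hfL.continuous.measurable.ennreal_ofReal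
  have hlip := lipschitzWith_integral_pow hL hκ hfL hf1
  have hprob : ∀ n u, IsProbabilityMeasure ((κ ^ n) u) := fun n u => by
    rw [← lawAt_dirac]; exact isProbabilityMeasure_lawAt κ _ n
  have hzero : ∀ n, ∫ w, f w ∂((κ ^ n) u₀) = 0 := fun n => by
    refine integral_eq_zero_of_ae ?_
    have h := staysInUnitBox_dirac hu₀ n
    rw [lawAt_dirac] at h
    filter_upwards [h] with w hw
    have : max (‖w‖ - 1) 0 = 0 := max_eq_right (by linarith)
    simp [f, this]
  have hle : ∀ n u, ∫⁻ w, ENNReal.ofReal (f w) ∂((κ ^ n) u) ≤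
      ENNReal.ofReal ((L : ℝ) ^ n * ‖u - u₀‖) := fun n u => by
    have h1 := hprob n u
    rw [← ofReal_integral_eq_lintegral_ofReal
      (Integrable.of_bound hfL.continuous.measurable.aestronglyMeasurable 1 (.of_forall hf1))
      (.of_forall hf0)]
    refine ENNReal.ofReal_le_ofReal ?_
    have h2 := (hlip n).dist_le_mul u u₀
    rw [hzero, dist_zero_right, dist_eq_norm] at h2
    exact (le_abs_self _).trans (by exact_mod_cast h2)
  have hconst : ∀ n : ℕ, ∫⁻ u, ENNReal.ofReal (f u) ∂m =
      ∫⁻ u, ∫⁻ w, ENNReal.ofReal (f w) ∂((κ ^ n) u) ∂m := fun n => by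
    conv_lhs => rw [← lawAt_of_invariant hm n]
    exact Measure.lintegral_bind (Kernel.aemeasurable _) hfm.aemeasurable
  have hlim : Tendsto (fun n : ℕ => ∫⁻ u, ∫⁻ w, ENNReal.ofReal (f w) ∂((κ ^ n) u) ∂m) atTop
      (𝓝 (∫⁻ _, 0 ∂m)) := by
    refine tendsto_lintegral_of_dominated_convergence (fun _ => 1) (fun n => ?_) (fun n => ?_)
      (by simp) (.of_forall fun u => ?_)
    · exact hfm.lintegral_kernel
    · refine .of_forall fun u => ?_
      have h1 := hprob n u
      refine (lintegral_mono fun w => ENNReal.ofReal_le_one.2 (hfle w)).trans (by simp)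
    · have hL1' : (L : ℝ) < 1 := by exact_mod_cast hL1
      have h2 := (tendsto_pow_atTop_nhds_zero_of_lt_one L.coe_nonneg hL1').mul_const ‖u - u₀‖
      rw [zero_mul] at h2
      have h3 := ENNReal.tendsto_ofReal h2
      rw [ENNReal.ofReal_zero] at h3
      exact tendsto_of_tendsto_of_tendsto_of_le_of_le tendsto_const_nhds h3 (fun _ => zero_le)
        fun n => hle n u
  have hfin : ∫⁻ u, ENNReal.ofReal (f u) ∂m = 0 := by
    have h2 := tendsto_nhds_unique (hlim.congr fun n => (hconst n).symm) tendsto_const_nhds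
    simpa using h2.symm
  rw [lintegral_eq_zero_iff hfm] at hfin
  filter_upwards [hfin] with u hu
  by_contra hgt
  have h1 : 0 < f u := lt_min (lt_max_of_lt_left (by linarith)) one_pos
  have h2 : ENNReal.ofReal (f u) = 0 := hu
  rw [ENNReal.ofReal_eq_zero] at h2
  linarith

end DataChain

/-! ### The joint kernel -/

section Joint

variable {d dZ N : ℕ} (κ : Kernel (Data d dZ) (Data d dZ)) (ν : Measure ℝ) (φ : ℝ → ℝ)
  (θ : Params d N)

instance : BorelSpace (FirstDeriv d N) := Prod.borelSpace
instance : BorelSpace (SecondDeriv d N) := Prod.borelSpace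
instance : BorelSpace (Hidden d N) := Prod.borelSpace
instance : BorelSpace (State d dZ N) := Prod.borelSpace

instance [IsMarkovKernel κ] [IsProbabilityMeasure ν] :
    IsMarkovKernel (jointKernel κ ν φ θ) := by
  unfold jointKernel; infer_instance

theorem jointKernel_apply [IsMarkovKernel κ] [IsProbabilityMeasure ν] (h : State d dZ N) :
    jointKernel κ ν φ θ h =
      ((κ h.1).prod ν).map fun p => (p.1, step φ θ (h.1, h.2.1), p.2) := by
  rw [jointKernel, Kernel.prod_apply, Kernel.prod_apply, Kernel.comap_apply,
    Kernel.deterministic_apply, Kernel.const_apply, Measure.dirac_prod]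
  conv_lhs => rw [← Measure.map_id (μ := κ h.1)]
  rw [Measure.map_prod_map _ _ measurable_id (by fun_prop)]
  rfl

variable [IsMarkovKernel κ] [IsProbabilityMeasure ν]

theorem map_fst_jointKernel (h : State d dZ N) : (jointKernel κ ν φ θ h).map Prod.fst = κ h.1 := by
  rw [jointKernel_apply, Measure.map_map (by fun_prop) (by fun_prop)]
  exact Measure.map_fst_prod.trans (by simp)

theorem map_noise_jointKernel (h : State d dZ N) :
    (jointKernel κ ν φ θ h).map (fun h => h.2.2) = ν := by
  rw [jointKernel_apply, Measure.map_map (by fun_prop) (by fun_prop)]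
  exact Measure.map_snd_prod.trans (by simp)

theorem map_fst_bind_jointKernel (π : Measure (State d dZ N)) :
    (π.bind (jointKernel κ ν φ θ)).map Prod.fst = (π.map Prod.fst).bind κ := by
  rw [map_bind_eq (Kernel.measurable _) measurable_fst, bind_map_eq measurable_fst κ.measurable]
  simp only [map_fst_jointKernel]

theorem map_noise_bind_jointKernel (π : Measure (State d dZ N)) [IsProbabilityMeasure π] :
    (π.bind (jointKernel κ ν φ θ)).map (fun h => h.2.2) = ν := by
  rw [map_bind_eq (Kernel.measurable _) (by fun_prop)]
  simp only [map_noise_jointKernel]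
  refine Measure.ext fun s hs => ?_
  rw [Measure.bind_apply hs aemeasurable_const]
  simp

theorem ae_jointKernel {p : State d dZ N → Prop} (hp : MeasurableSet {h | p h})
    {h : State d dZ N} (hh : ∀ᵐ w ∂(κ h.1), ∀ y, p (w, step φ θ (h.1, h.2.1), y)) :
    ∀ᵐ h' ∂(jointKernel κ ν φ θ h), p h' := by
  rw [jointKernel_apply, ae_map_iff (by fun_prop) hp]
  have : ∀ᵐ z ∂((κ h.1).prod ν), ∀ y, p (z.1, step φ θ (h.1, h.2.1), y) :=
    Measure.quasiMeasurePreserving_fst.ae hh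
  filter_upwards [this] with z hz using hz z.2

/-- The synchronous coupling: the data move by a nearly optimal coupling, and the noise is shared. -/
theorem exists_isCoupling_jointKernel {h h' : State d dZ N} {b ε : ℝ} (hε : 0 < ε)
    (hb : wass 2 (κ h.1) (κ h'.1) ≤ ENNReal.ofReal b) :
    ∃ γ, IsCoupling γ (jointKernel κ ν φ θ h) (jointKernel κ ν φ θ h') ∧
      (∀ᵐ z ∂γ, z.1.2.1 = step φ θ (h.1, h.2.1) ∧ z.2.2.1 = step φ θ (h'.1, h'.2.1) ∧
        z.1.2.2 = z.2.2.2) ∧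
      ∫⁻ z, ENNReal.ofReal (‖z.1.1 - z.2.1‖ ^ 2) ∂γ ≤ ENNReal.ofReal (b ^ 2 + ε) := by
  obtain ⟨γ₀, hγ₀, hcost⟩ := exists_isCoupling_of_wass_two_le hε hb
  have := hγ₀.isProbabilityMeasure
  let g : (Data d dZ × Data d dZ) × ℝ → State d dZ N × State d dZ N := fun p =>
    ((p.1.1, step φ θ (h.1, h.2.1), p.2), (p.1.2, step φ θ (h'.1, h'.2.1), p.2))
  have hg : Measurable g := by fun_prop
  refine ⟨(γ₀.prod ν).map g, ⟨?_, ?_⟩, ?_, ?_⟩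
  · rw [Measure.map_map measurable_fst hg, jointKernel_apply, ← hγ₀.1]
    conv_rhs => rw [← Measure.map_id (μ := ν)]
    rw [Measure.map_prod_map _ _ measurable_fst measurable_id,
      Measure.map_map (by fun_prop) (by fun_prop)]
    rfl
  · rw [Measure.map_map measurable_snd hg, jointKernel_apply, ← hγ₀.2]
    conv_rhs => rw [← Measure.map_id (μ := ν)]
    rw [Measure.map_prod_map _ _ measurable_snd measurable_id,
      Measure.map_map (by fun_prop) (by fun_prop)]
    rfl
  · refine (ae_map_iff hg.aemeasurable ?_).2 (.of_forall fun p => ⟨rfl, rfl, rfl⟩)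
    have h1 : Measurable fun z : State d dZ N × State d dZ N => z.1.2.1 := by fun_prop
    have h2 : Measurable fun z : State d dZ N × State d dZ N => z.2.2.1 := by fun_prop
    exact (h1 isClosed_singleton.measurableSet).inter
      ((h2 isClosed_singleton.measurableSet).inter (measurableSet_eq_fun (by fun_prop) (by fun_prop)))
  · rw [lintegral_map (by fun_prop) hg, lintegral_prod _ (by fun_prop)]
    simp only [g, lintegral_const, measure_univ, mul_one]
    refine le_trans (le_of_eq (lintegral_congr fun z => ?_)) hcost
    rw [← ofReal_norm, ENNReal.ofReal_rpow_of_nonneg (norm_nonneg _) (by norm_num), Real.rpow_two]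

end Joint

/-! ### Exponential merging of the joint chain -/

section Merging

variable {d dZ N : ℕ}

theorem enorm_rpow_two {E : Type*} [SeminormedAddCommGroup E] (x : E) :
    ‖x‖ₑ ^ (2 : ℝ) = ENNReal.ofReal (‖x‖ ^ 2) := by
  rw [← ofReal_norm, ENNReal.ofReal_rpow_of_nonneg (norm_nonneg _) (by norm_num), Real.rpow_two]

theorem norm_state_sq_le (h : State d dZ N) : ‖h‖ ^ 2 ≤ ‖h.1‖ ^ 2 + ‖h.2.1‖ ^ 2 + ‖h.2.2‖ ^ 2 := by
  have h1 := sq_nonneg ‖h.1‖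
  have h2 := sq_nonneg ‖h.2.1‖
  have h3 := sq_nonneg ‖h.2.2‖
  rw [Prod.norm_def h, Prod.norm_def h.2]
  rcases max_choice ‖h.1‖ (max ‖h.2.1‖ ‖h.2.2‖) with e | e <;> rw [e]
  · linarith
  · rcases max_choice ‖h.2.1‖ ‖h.2.2‖ with e' | e' <;> rw [e'] <;> linarith

/-- The squared distance of the data plus the squared weighted distance of the hidden states. -/
def baseCost (a₁ a₂ : ℝ) (z : State d dZ N × State d dZ N) : ℝ :=
  ‖z.1.1 - z.2.1‖ ^ 2 + wnorm a₁ a₂ (z.1.2.1 - z.2.2.1) ^ 2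

/-- The cost `baseCost` plus the squared distance of the noises. -/
def fullCost (a₁ a₂ : ℝ) (z : State d dZ N × State d dZ N) : ℝ :=
  baseCost a₁ a₂ z + ‖z.1.2.2 - z.2.2.2‖ ^ 2

theorem continuous_baseCost (a₁ a₂ : ℝ) :
    Continuous (baseCost (d := d) (dZ := dZ) (N := N) a₁ a₂) := by
  have := continuous_wnorm (d := d) (N := N) a₁ a₂
  unfold baseCost; fun_prop

theorem continuous_fullCost (a₁ a₂ : ℝ) :
    Continuous (fullCost (d := d) (dZ := dZ) (N := N) a₁ a₂) := by
  have := continuous_baseCost (d := d) (dZ := dZ) (N := N) a₁ a₂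
  unfold fullCost; fun_prop

theorem baseCost_nonneg (a₁ a₂ : ℝ) (z : State d dZ N × State d dZ N) : 0 ≤ baseCost a₁ a₂ z := by
  unfold baseCost; positivity

theorem fullCost_nonneg (a₁ a₂ : ℝ) (z : State d dZ N × State d dZ N) : 0 ≤ fullCost a₁ a₂ z :=
  add_nonneg (baseCost_nonneg _ _ _) (by positivity)

theorem wnorm_nonneg {a₁ a₂ : ℝ} (ha₁ : 0 ≤ a₁) (ha₂ : 0 ≤ a₂) (v : Hidden d N) :
    0 ≤ wnorm a₁ a₂ v := by
  unfold wnorm; positivity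

theorem wnorm_sub_le {a₁ a₂ k₀ k₁ k₂ : ℝ} (ha₁ : 0 ≤ a₁) (ha₂ : 0 ≤ a₂) {v v' : Hidden d N}
    (hv : v ∈ box d N k₀ k₁ k₂) (hv' : v' ∈ box d N k₀ k₁ k₂) :
    wnorm a₁ a₂ (v - v') ≤ 2 * (k₀ + a₁ * k₁ + a₂ * k₂) := by
  have h0 : ‖v.1 - v'.1‖ ≤ k₀ + k₀ := norm_sub_le_of_le hv.1 hv'.1
  have h1 : ‖v.2.1 - v'.2.1‖ ≤ k₁ + k₁ := norm_sub_le_of_le hv.2.1 hv'.2.1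
  have h2 : ‖v.2.2 - v'.2.2‖ ≤ k₂ + k₂ := norm_sub_le_of_le hv.2.2 hv'.2.2
  change ‖v.1 - v'.1‖ + a₁ * ‖v.2.1 - v'.2.1‖ + a₂ * ‖v.2.2 - v'.2.2‖ ≤ _
  have h1' := mul_le_mul_of_nonneg_left h1 ha₁
  have h2' := mul_le_mul_of_nonneg_left h2 ha₂
  linarith

/-- The weighted norm is equivalent to the max norm. -/
theorem exists_norm_sq_le_fullCost {a₁ a₂ : ℝ} (ha₁ : 0 < a₁) (ha₂ : 0 < a₂) :
    ∃ A : ℝ, 0 < A ∧ ∀ z : State d dZ N × State d dZ N, ‖z.1 - z.2‖ ^ 2 ≤ A * fullCost a₁ a₂ z := by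
  obtain ⟨m, hm⟩ : ∃ m, m = min 1 (min a₁ a₂) := ⟨_, rfl⟩
  have hm0 : 0 < m := by rw [hm]; positivity
  have hm1 : m ≤ 1 := hm.trans_le (min_le_left _ _)
  have hma₁ : m ≤ a₁ := hm.trans_le ((min_le_right _ _).trans (min_le_left _ _))
  have hma₂ : m ≤ a₂ := hm.trans_le ((min_le_right _ _).trans (min_le_right _ _))
  refine ⟨(m ^ 2)⁻¹, by positivity, fun z => ?_⟩
  rw [le_inv_mul_iff₀ (by positivity)]
  have hw : m * ‖z.1.2.1 - z.2.2.1‖ ≤ wnorm a₁ a₂ (z.1.2.1 - z.2.2.1) := by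
    generalize z.1.2.1 - z.2.2.1 = v
    have h0 := norm_nonneg v.1
    have h1 : 0 ≤ a₁ * ‖v.2.1‖ := by positivity
    have h2 : 0 ≤ a₂ * ‖v.2.2‖ := by positivity
    have e0 : m * ‖v.1‖ ≤ ‖v.1‖ := mul_le_of_le_one_left h0 hm1
    have e1 : m * ‖v.2.1‖ ≤ a₁ * ‖v.2.1‖ := by gcongr
    have e2 : m * ‖v.2.2‖ ≤ a₂ * ‖v.2.2‖ := by gcongr
    unfold wnorm
    rw [Prod.norm_def v, Prod.norm_def v.2]
    rcases max_choice ‖v.1‖ (max ‖v.2.1‖ ‖v.2.2‖) with e | e <;> rw [e]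
    · linarith
    · rcases max_choice ‖v.2.1‖ ‖v.2.2‖ with e' | e' <;> rw [e'] <;> linarith
  have hw2 := pow_le_pow_left₀ (by positivity) hw 2
  rw [mul_pow] at hw2
  have hn := norm_state_sq_le (z.1 - z.2)
  have hm2 : m ^ 2 ≤ 1 := pow_le_one₀ hm0.le hm1
  have hu : m ^ 2 * ‖z.1.1 - z.2.1‖ ^ 2 ≤ ‖z.1.1 - z.2.1‖ ^ 2 :=
    mul_le_of_le_one_left (by positivity) hm2
  have hη : m ^ 2 * ‖z.1.2.2 - z.2.2.2‖ ^ 2 ≤ ‖z.1.2.2 - z.2.2.2‖ ^ 2 :=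
    mul_le_of_le_one_left (by positivity) hm2
  calc m ^ 2 * ‖z.1 - z.2‖ ^ 2 ≤ m ^ 2 * (‖z.1.1 - z.2.1‖ ^ 2 + ‖z.1.2.1 - z.2.2.1‖ ^ 2 +
        ‖z.1.2.2 - z.2.2.2‖ ^ 2) := by gcongr; exact hn
    _ ≤ fullCost a₁ a₂ z := by unfold fullCost baseCost; linarith

theorem measurableSet_region {κ : Kernel (Data d dZ) (Data d dZ)} {k₀ k₁ k₂ : ℝ} :
    MeasurableSet {h : State d dZ N | h.1 ∈ goodData κ ∧ h.2.1 ∈ box d N k₀ k₁ k₂} :=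
  (measurable_fst measurableSet_goodData).inter
    ((measurable_fst.comp measurable_snd) (isClosed_box k₀ k₁ k₂).measurableSet)

variable {κ : Kernel (Data d dZ) (Data d dZ)} [IsMarkovKernel κ] {ν : Measure ℝ}
  [IsProbabilityMeasure ν] {φ : ℝ → ℝ} {Lκ : ℝ}
  (hκ : ∀ u u', wass 2 (κ u) (κ u') ≤ ENNReal.ofReal (Lκ * ‖u - u'‖))

include hκ in
theorem isFeller_jointKernel (θ : Params d N) : IsFeller (jointKernel κ ν φ θ) := by
  have hF := continuous_step (dZ := dZ) φ θ
  let B : State d dZ N → State d dZ N → ℝ := fun x y =>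
    (Lκ * ‖x.1 - y.1‖) ^ 2 + ‖step φ θ (x.1, x.2.1) - step φ θ (y.1, y.2.1)‖ ^ 2
  refine isFeller_of_wass_le (b := fun x y => Real.sqrt (B x y)) (fun x => ?_) fun x y => ?_
  · have hc : Continuous fun y => Real.sqrt (B y x) := by fun_prop
    have := hc.tendsto x
    simpa [B] using this
  · have hε : ∀ ε > 0, wass 2 (jointKernel κ ν φ θ x) (jointKernel κ ν φ θ y) ≤
        ENNReal.ofReal (Real.sqrt (B x y + ε)) := fun ε hε => by
      obtain ⟨γ, hγ, hae, hcost⟩ := exists_isCoupling_jointKernel κ ν φ θ hε (hκ x.1 y.1)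
      have := hγ.isProbabilityMeasure
      refine wass_two_le_of_isCoupling hγ ?_
      calc ∫⁻ z, ‖z.1 - z.2‖ₑ ^ (2 : ℝ) ∂γ
          ≤ ∫⁻ z, (ENNReal.ofReal (‖z.1.1 - z.2.1‖ ^ 2) +
            ENNReal.ofReal (‖step φ θ (x.1, x.2.1) - step φ θ (y.1, y.2.1)‖ ^ 2)) ∂γ := by
            refine lintegral_mono_ae ?_
            filter_upwards [hae] with z hz
            rw [enorm_rpow_two, ← ENNReal.ofReal_add (by positivity) (by positivity)]
            refine ENNReal.ofReal_le_ofReal ((norm_state_sq_le _).trans ?_)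
            have e1 : (z.1 - z.2).2.1 = step φ θ (x.1, x.2.1) - step φ θ (y.1, y.2.1) := by
              rw [← hz.1, ← hz.2.1]; rfl
            have e2 : (z.1 - z.2).2.2 = 0 := sub_eq_zero.2 hz.2.2
            rw [e1, e2, norm_zero]
            exact le_of_eq (by simp)
        _ ≤ _ := by
            rw [lintegral_add_right _ (by fun_prop), lintegral_const, measure_univ, mul_one]
            refine (add_le_add_left hcost _).trans ?_
            rw [← ENNReal.ofReal_add (by positivity) (by positivity)]
            exact ENNReal.ofReal_le_ofReal (by simp only [B]; linarith)
    have hc : Continuous fun ε => ENNReal.ofReal (Real.sqrt (B x y + ε)) :=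
      ENNReal.continuous_ofReal.comp (by fun_prop)
    have hlim : Tendsto (fun ε => ENNReal.ofReal (Real.sqrt (B x y + ε))) (𝓝[>] 0)
        (𝓝 (ENNReal.ofReal (Real.sqrt (B x y)))) := by
      have := (hc.tendsto 0).mono_left (nhdsWithin_le_nhds (s := Set.Ioi 0))
      simpa using this
    exact ge_of_tendsto hlim (eventually_mem_nhdsWithin.mono fun ε h => hε ε h)

variable {C C₁ C₂ : ℝ} (hC : 0 < C) (hC1 : C < 1) (hφ₀ : ∀ y, |φ y| ≤ C)
  (hφ₁ : ∀ y, |deriv φ y| ≤ C₁) (hφ₂ : ∀ y, |deriv (deriv φ) y| ≤ C₂)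

include hκ hC hC1 hφ₀ hφ₁ hφ₂ in
/-- Two joint chains with good data, hidden states bounded by `K` and noises of second moment at
most `S` merge at the rate `√(Lκ ^ 2 + C ^ 2)`, uniformly in the parameters of the network. -/
theorem exists_wass_lawAt_le {K S : ℝ} (hK : 0 ≤ K) (hS : 0 ≤ S) :
    ∃ k₀ k₁ k₂ C' : ℝ, K ≤ k₀ ∧ K ≤ k₁ ∧ K ≤ k₂ ∧ 0 < C' ∧ ∀ θ : Params d N,
      (∀ (u : Data d dZ), ‖u‖ ≤ 1 → ∀ v ∈ box d N k₀ k₁ k₂, step φ θ (u, v) ∈ box d N k₀ k₁ k₂) ∧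
      ∀ μ μ' : Measure (State d dZ N), IsProbabilityMeasure μ → IsProbabilityMeasure μ' →
        (∀ᵐ h ∂μ, h.1 ∈ goodData κ ∧ h.2.1 ∈ box d N k₀ k₁ k₂) →
        (∀ᵐ h ∂μ', h.1 ∈ goodData κ ∧ h.2.1 ∈ box d N k₀ k₁ k₂) →
        ∫⁻ h, ‖h.2.2‖ₑ ^ (2 : ℝ) ∂μ ≤ ENNReal.ofReal S →
        ∫⁻ h, ‖h.2.2‖ₑ ^ (2 : ℝ) ∂μ' ≤ ENNReal.ofReal S → ∀ t,
        wass 2 (lawAt (jointKernel κ ν φ θ) μ t) (lawAt (jointKernel κ ν φ θ) μ' t) ≤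
          ENNReal.ofReal (C' * Real.sqrt (Lκ ^ 2 + C ^ 2) ^ t) := by
  obtain ⟨k₀, k₁, k₂, a₁, a₂, hk₀, hk₁, hk₂, ha₁, ha₂, hbox⟩ :=
    exists_box_contraction (d := d) (dZ := dZ) (N := N) hC hC1 hφ₀ hφ₁ hφ₂ hK
  obtain ⟨A, hA, hnorm⟩ := exists_norm_sq_le_fullCost (d := d) (dZ := dZ) (N := N) ha₁ ha₂
  obtain ⟨B, hBdef⟩ : ∃ B, B = 2 ^ 2 + (2 * (k₀ + a₁ * k₁ + a₂ * k₂)) ^ 2 := ⟨_, rfl⟩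
  have hB0 : 0 ≤ B := by rw [hBdef]; positivity
  refine ⟨k₀, k₁, k₂, Real.sqrt (A * (B + 4 * S)) + 1, hk₀, hk₁, hk₂, by positivity,
    fun θ => ⟨(hbox θ).1, fun μ μ' hμp hμp' hμ hμ' hS1 hS2 t => ?_⟩⟩
  let R : Set (State d dZ N) := {h | h.1 ∈ goodData κ ∧ h.2.1 ∈ box d N k₀ k₁ k₂}
  have hRm : MeasurableSet R := measurableSet_region
  have hR : ∀ h ∈ R, ∀ᵐ h' ∂(jointKernel κ ν φ θ h), h' ∈ R := fun h hh =>
    ae_jointKernel κ ν φ θ hRm ((ae_kernel_mem_goodData hh.1).mono fun w hw _ =>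
      ⟨hw, (hbox θ).1 h.1 (norm_le_one_of_mem_goodData hh.1) _ hh.2⟩)
  have hB : ∀ x ∈ R, ∀ y ∈ R, baseCost a₁ a₂ (x, y) ≤ B := fun x hx y hy => by
    rw [hBdef, baseCost]
    gcongr
    · have := norm_sub_le_of_le (norm_le_one_of_mem_goodData hx.1)
        (norm_le_one_of_mem_goodData hy.1)
      exact this.trans (by norm_num)
    · exact wnorm_nonneg ha₁.le ha₂.le _
    · exact wnorm_sub_le ha₁.le ha₂.le hx.2 hy.2
  obtain ⟨r, hr⟩ : ∃ r, r = Lκ ^ 2 + C ^ 2 := ⟨_, rfl⟩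
  have hr0 : 0 ≤ r := by rw [hr]; positivity
  have hPc : ∀ x ∈ R, ∀ y ∈ R, ∀ ε > 0, ∃ γ,
      IsCoupling γ (jointKernel κ ν φ θ x) (jointKernel κ ν φ θ y) ∧
      ∫⁻ z, ENNReal.ofReal (fullCost a₁ a₂ z) ∂γ ≤
        ENNReal.ofReal (r * baseCost a₁ a₂ (x, y)) + ENNReal.ofReal ε := by
    intro x hx y hy ε hε
    obtain ⟨γ, hγ, hae, hcost⟩ := exists_isCoupling_jointKernel κ ν φ θ hε (hκ x.1 y.1)
    have := hγ.isProbabilityMeasure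
    refine ⟨γ, hγ, ?_⟩
    have hstep := (hbox θ).2 x.1 y.1 (norm_le_one_of_mem_goodData hx.1)
      (norm_le_one_of_mem_goodData hy.1) _ hx.2 _ hy.2
    have hw0 := wnorm_nonneg ha₁.le ha₂.le (step φ θ (x.1, x.2.1) - step φ θ (y.1, y.2.1))
    have hw1 := wnorm_nonneg ha₁.le ha₂.le (x.2.1 - y.2.1)
    calc ∫⁻ z, ENNReal.ofReal (fullCost a₁ a₂ z) ∂γ
        ≤ ∫⁻ z, (ENNReal.ofReal (‖z.1.1 - z.2.1‖ ^ 2) + ENNReal.ofReal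
            (wnorm a₁ a₂ (step φ θ (x.1, x.2.1) - step φ θ (y.1, y.2.1)) ^ 2)) ∂γ := by
          refine lintegral_mono_ae ?_
          filter_upwards [hae] with z hz
          rw [← ENNReal.ofReal_add (by positivity) (by positivity), fullCost, baseCost, hz.1,
            hz.2.1, hz.2.2, sub_self, norm_zero]
          exact le_of_eq (by simp)
      _ ≤ ENNReal.ofReal ((Lκ * ‖x.1 - y.1‖) ^ 2 + ε) + ENNReal.ofReal
            (wnorm a₁ a₂ (step φ θ (x.1, x.2.1) - step φ θ (y.1, y.2.1)) ^ 2) := by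
          rw [lintegral_add_right _ (by fun_prop), lintegral_const, measure_univ, mul_one]
          gcongr
      _ ≤ ENNReal.ofReal (r * baseCost a₁ a₂ (x, y)) + ENNReal.ofReal ε := by
          rw [← ENNReal.ofReal_add (by positivity) (by positivity),
            ← ENNReal.ofReal_add (mul_nonneg hr0 (baseCost_nonneg _ _ _)) hε.le]
          refine ENNReal.ofReal_le_ofReal ?_
          have h2 := pow_le_pow_left₀ hw0 hstep 2
          rw [hr, baseCost]
          generalize wnorm a₁ a₂ (step φ θ (x.1, x.2.1) - step φ θ (y.1, y.2.1)) = e' at *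
          simp only
          generalize wnorm a₁ a₂ (x.2.1 - y.2.1) = e at *
          generalize ‖x.1 - y.1‖ = D at *
          have q1 : 0 ≤ C ^ 2 * (D - e) ^ 2 := by positivity
          have q2 : 0 ≤ C ^ 2 * D ^ 2 := by positivity
          have q3 : 0 ≤ C ^ 2 * e ^ 2 := by positivity
          have q4 : 0 ≤ Lκ ^ 2 * e ^ 2 := by positivity
          linarith
  have hΓ : IsCoupling (μ.prod μ') μ μ' :=
    ⟨Measure.map_fst_prod.trans (by simp), Measure.map_snd_prod.trans (by simp)⟩
  obtain ⟨Γ', hΓ', hcost⟩ := exists_isCoupling_lawAt (isFeller_jointKernel (ν := ν) (φ := φ) hκ θ)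
    hRm hR (continuous_fullCost a₁ a₂) (fullCost_nonneg a₁ a₂) (continuous_baseCost a₁ a₂)
    (fun z => le_add_of_nonneg_right (by positivity)) hB hr0 hPc hμ hμ' hΓ t
  have hinit : ∫⁻ z, ENNReal.ofReal (fullCost a₁ a₂ z) ∂(μ.prod μ') ≤
      ENNReal.ofReal (B + 4 * S) := by
    have h1 : ∀ᵐ z ∂(μ.prod μ'), z.1 ∈ R := Measure.quasiMeasurePreserving_fst.ae hμ
    have h2 : ∀ᵐ z ∂(μ.prod μ'), z.2 ∈ R := Measure.quasiMeasurePreserving_snd.ae hμ'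
    have hm : Measurable fun h : State d dZ N => ‖h.2.2‖ₑ ^ (2 : ℝ) := by fun_prop
    have i1 : ∫⁻ z, ‖z.1.2.2‖ₑ ^ (2 : ℝ) ∂(μ.prod μ') ≤ ENNReal.ofReal S := by
      rw [← lintegral_map hm measurable_fst, hΓ.1]; exact hS1
    have i2 : ∫⁻ z, ‖z.2.2.2‖ₑ ^ (2 : ℝ) ∂(μ.prod μ') ≤ ENNReal.ofReal S := by
      rw [← lintegral_map hm measurable_snd, hΓ.2]; exact hS2
    calc ∫⁻ z, ENNReal.ofReal (fullCost a₁ a₂ z) ∂(μ.prod μ')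
        ≤ ∫⁻ z, (ENNReal.ofReal B + (2 * ‖z.1.2.2‖ₑ ^ (2 : ℝ) + 2 * ‖z.2.2.2‖ₑ ^ (2 : ℝ)))
            ∂(μ.prod μ') := by
          refine lintegral_mono_ae ?_
          filter_upwards [h1, h2] with z hz1 hz2
          rw [enorm_rpow_two, enorm_rpow_two, ← ENNReal.ofReal_ofNat 2,
            ← ENNReal.ofReal_mul (by norm_num), ← ENNReal.ofReal_mul (by norm_num),
            ← ENNReal.ofReal_add (by positivity) (by positivity),
            ← ENNReal.ofReal_add hB0 (by positivity)]
          refine ENNReal.ofReal_le_ofReal (add_le_add (hB _ hz1 _ hz2) ?_)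
          simp only [Real.norm_eq_abs, sq_abs]
          linarith [sq_nonneg (z.1.2.2 + z.2.2.2)]
      _ = ENNReal.ofReal B + (2 * ∫⁻ z, ‖z.1.2.2‖ₑ ^ (2 : ℝ) ∂(μ.prod μ') +
            2 * ∫⁻ z, ‖z.2.2.2‖ₑ ^ (2 : ℝ) ∂(μ.prod μ')) := by
          rw [lintegral_add_left (by fun_prop), lintegral_add_left (by fun_prop),
            lintegral_const_mul _ (by fun_prop), lintegral_const_mul _ (by fun_prop)]
          simp
      _ ≤ ENNReal.ofReal B + (2 * ENNReal.ofReal S + 2 * ENNReal.ofReal S) := by gcongr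
      _ = ENNReal.ofReal (B + 4 * S) := by
          rw [← ENNReal.ofReal_ofNat 2, ← ENNReal.ofReal_mul (by norm_num),
            ← ENNReal.ofReal_add (by positivity) (by positivity),
            ← ENNReal.ofReal_add hB0 (by positivity)]
          congr 1; ring
  have hfinal : ∫⁻ z, ‖z.1 - z.2‖ₑ ^ (2 : ℝ) ∂Γ' ≤ ENNReal.ofReal (A * (B + 4 * S) * r ^ t) := by
    calc ∫⁻ z, ‖z.1 - z.2‖ₑ ^ (2 : ℝ) ∂Γ'
        ≤ ∫⁻ z, ENNReal.ofReal A * ENNReal.ofReal (fullCost a₁ a₂ z) ∂Γ' := by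
          refine lintegral_mono fun z => ?_
          rw [enorm_rpow_two, ← ENNReal.ofReal_mul hA.le]
          exact ENNReal.ofReal_le_ofReal (hnorm z)
      _ = ENNReal.ofReal A * ∫⁻ z, ENNReal.ofReal (fullCost a₁ a₂ z) ∂Γ' :=
          lintegral_const_mul _ (continuous_fullCost a₁ a₂).measurable.ennreal_ofReal
      _ ≤ ENNReal.ofReal A * (ENNReal.ofReal (r ^ t) * ENNReal.ofReal (B + 4 * S)) := by
          gcongr
          exact hcost.trans (by gcongr)
      _ = _ := by
          rw [← ENNReal.ofReal_mul (by positivity), ← ENNReal.ofReal_mul hA.le]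
          congr 1; ring
  refine (wass_two_le_of_isCoupling hΓ' hfinal).trans (ENNReal.ofReal_le_ofReal ?_)
  rw [Real.sqrt_mul (by positivity), Real.sqrt_eq_rpow (r ^ t), ← Real.rpow_natCast,
    ← Real.rpow_mul hr0, mul_comm (t : ℝ), Real.rpow_mul hr0, Real.rpow_natCast,
    ← Real.sqrt_eq_rpow, ← hr]
  gcongr
  linarith

end Merging

/-! ### The invariant law -/

section Invariant

variable {d dZ N : ℕ} {κ : Kernel (Data d dZ) (Data d dZ)} [IsMarkovKernel κ] {ν : Measure ℝ}
  [IsProbabilityMeasure ν] {φ : ℝ → ℝ} {Lκ : ℝ}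

theorem isCompact_box (k₀ k₁ k₂ : ℝ) : IsCompact (box d N k₀ k₁ k₂) := by
  refine Metric.isCompact_of_isClosed_isBounded (isClosed_box k₀ k₁ k₂) ?_
  refine (Metric.isBounded_closedBall (x := (0 : Hidden d N)) (r := max k₀ (max k₁ k₂))).subset ?_
  intro v hv
  rw [mem_closedBall_zero_iff]
  exact max_le_max hv.1 (max_le_max hv.2.1 hv.2.2)

theorem zero_mem_box {k₀ k₁ k₂ : ℝ} (h₀ : 0 ≤ k₀) (h₁ : 0 ≤ k₁) (h₂ : 0 ≤ k₂) :
    (0 : Hidden d N) ∈ box d N k₀ k₁ k₂ :=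
  ⟨by simpa using h₀, by simpa using h₁, by simpa using h₂⟩

theorem mem_box_of_norm_le {k₀ k₁ k₂ K : ℝ} (h₀ : K ≤ k₀) (h₁ : K ≤ k₁) (h₂ : K ≤ k₂)
    {v : Hidden d N} (hv : ‖v‖ ≤ K) : v ∈ box d N k₀ k₁ k₂ :=
  ⟨(norm_fst_le v).trans (hv.trans h₀),
    ((norm_fst_le v.2).trans (norm_snd_le v)).trans (hv.trans h₁),
    ((norm_snd_le v.2).trans (norm_snd_le v)).trans (hv.trans h₂)⟩

theorem lintegral_noise_bind_jointKernel (θ : Params d N) (π : Measure (State d dZ N))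
    [IsProbabilityMeasure π] :
    ∫⁻ h, ‖h.2.2‖ₑ ^ (2 : ℝ) ∂(π.bind (jointKernel κ ν φ θ)) = ∫⁻ y, ‖y‖ₑ ^ (2 : ℝ) ∂ν := by
  conv_rhs => rw [← map_noise_bind_jointKernel κ ν φ θ π]
  exact (lintegral_map (f := fun y : ℝ => ‖y‖ₑ ^ (2 : ℝ)) (g := fun h : State d dZ N => h.2.2)
    (by fun_prop) (by fun_prop)).symm

theorem ae_mem_lawAt_jointKernel {θ : Params d N} {k₀ k₁ k₂ : ℝ}
    (hbox : ∀ (u : Data d dZ), ‖u‖ ≤ 1 → ∀ v ∈ box d N k₀ k₁ k₂,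
      step φ θ (u, v) ∈ box d N k₀ k₁ k₂) {μ : Measure (State d dZ N)}
    (hμ : ∀ᵐ h ∂μ, h.1 ∈ goodData κ ∧ h.2.1 ∈ box d N k₀ k₁ k₂) (t : ℕ) :
    ∀ᵐ h ∂(lawAt (jointKernel κ ν φ θ) μ t), h.1 ∈ goodData κ ∧ h.2.1 ∈ box d N k₀ k₁ k₂ := by
  exact ae_mem_lawAt measurableSet_region (fun h hh => ae_jointKernel κ ν φ θ measurableSet_region
    ((ae_kernel_mem_goodData hh.1).mono fun w hw _ =>
      ⟨hw, hbox h.1 (norm_le_one_of_mem_goodData hh.1) _ hh.2⟩)) hμ t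

theorem ae_mem_of_tendsto {Y : Type*} [MetricSpace Y] [MeasurableSpace Y] [BorelSpace Y]
    {μs : ℕ → ProbabilityMeasure Y} {μ : ProbabilityMeasure Y} (h : Tendsto μs atTop (𝓝 μ))
    {F : Set Y} (hF : IsClosed F) (hμs : ∀ n, ∀ᵐ y ∂(μs n : Measure Y), y ∈ F) :
    ∀ᵐ y ∂(μ : Measure Y), y ∈ F := by
  have h1 := ProbabilityMeasure.limsup_measure_closed_le_of_tendsto h hF
  have h2 : ∀ n, (μs n : Measure Y) F = 1 := fun n =>
    (mem_ae_iff_prob_eq_one hF.measurableSet).1 (hμs n)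
  simp only [h2, limsup_const] at h1
  exact mem_ae_iff_prob_eq_one hF.measurableSet |>.2 (le_antisymm prob_le_one h1)

/-- The data marginal of any invariant law of the joint chain lives on the good points. -/
theorem ae_mem_goodData_of_invariant (hL : 0 ≤ Lκ) (hL1 : Lκ < 1)
    (hκ : ∀ u u', wass 2 (κ u) (κ u') ≤ ENNReal.ofReal (Lκ * ‖u - u'‖)) {u₀ : Data d dZ}
    (hu₀ : u₀ ∈ goodData κ) {θ : Params d N} {π : Measure (State d dZ N)} [IsProbabilityMeasure π]
    (hπ : Kernel.Invariant (jointKernel κ ν φ θ) π) : ∀ᵐ h ∂π, h.1 ∈ goodData κ := by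
  -- a positive Lipschitz constant that is still smaller than `1`
  let L : ℝ≥0 := ⟨(Lκ + 1) / 2, by linarith⟩
  have hL0 : 0 < L := show (0 : ℝ) < (Lκ + 1) / 2 by linarith
  have hL1' : L < 1 := show (Lκ + 1) / 2 < (1 : ℝ) by linarith
  have hκ' : ∀ u u', wass 2 (κ u) (κ u') ≤ L * ENNReal.ofReal ‖u - u'‖ := fun u u' => by
    refine (hκ u u').trans ?_
    rw [ENNReal.ofReal_mul hL]
    gcongr
    rw [← ENNReal.ofReal_coe_nnreal]
    exact ENNReal.ofReal_le_ofReal (show Lκ ≤ (Lκ + 1) / 2 by linarith)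
  have : IsProbabilityMeasure (π.map Prod.fst) :=
    Measure.isProbabilityMeasure_map measurable_fst.aemeasurable
  have hinv : Kernel.Invariant κ (π.map Prod.fst) := by
    rw [Kernel.Invariant, ← map_fst_bind_jointKernel κ ν φ θ, hπ.def]
  exact ae_of_ae_map measurable_fst.aemeasurable
    (ae_mem_goodData (staysInUnitBox_of_invariant hL0 hL1' hκ' hu₀ hinv))

variable {C C₁ C₂ : ℝ} (hC : 0 < C) (hq : Lκ ^ 2 + C ^ 2 < 1)
  (hφ₀ : ∀ y, |φ y| ≤ C) (hφ₁ : ∀ y, |deriv φ y| ≤ C₁) (hφ₂ : ∀ y, |deriv (deriv φ) y| ≤ C₂)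
  (hκ : ∀ u u', wass 2 (κ u) (κ u') ≤ ENNReal.ofReal (Lκ * ‖u - u'‖))
  (hν : ∫⁻ y, ‖y‖ₑ ^ (2 : ℝ) ∂ν < ∞) {u₀ : Data d dZ} (hu₀ : u₀ ∈ goodData κ)

theorem tendsto_ofReal_mul_sqrt_pow {q : ℝ} (hq : q < 1) (C' : ℝ) :
    Tendsto (fun t : ℕ => ENNReal.ofReal (C' * Real.sqrt q ^ t)) atTop (𝓝 0) := by
  have hs : Real.sqrt q < 1 := (Real.sqrt_lt' one_pos).2 (by simpa using hq)
  have := (tendsto_pow_atTop_nhds_zero_of_lt_one (Real.sqrt_nonneg q) hs).const_mul C'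
  rw [mul_zero] at this
  simpa using ENNReal.tendsto_ofReal this

include hC hq hφ₀ hφ₁ hφ₂ hκ hν hu₀ in
/-- The chain started from a good data point and the zero hidden state has an invariant weak limit
point, which inherits every bound on the hidden state that is stable under the recursion. -/
theorem exists_invariant_jointKernel (θ : Params d N) :
    ∃ μ : Measure (State d dZ N), IsProbabilityMeasure μ ∧
      Kernel.Invariant (jointKernel κ ν φ θ) μ ∧
      ∀ k₀ k₁ k₂ : ℝ, 0 ≤ k₀ → 0 ≤ k₁ → 0 ≤ k₂ →
        (∀ (u : Data d dZ), ‖u‖ ≤ 1 → ∀ v ∈ box d N k₀ k₁ k₂,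
          step φ θ (u, v) ∈ box d N k₀ k₁ k₂) →
        ∀ᵐ h ∂μ, h.2.1 ∈ box d N k₀ k₁ k₂ := by
  have hC1 : C < 1 := by nlinarith [sq_nonneg Lκ]
  let h₀ : State d dZ N := (u₀, 0, 0)
  obtain ⟨S, hS, hSν⟩ : ∃ S : ℝ, 0 ≤ S ∧ ∫⁻ y, ‖y‖ₑ ^ (2 : ℝ) ∂ν = ENNReal.ofReal S :=
    ⟨_, ENNReal.toReal_nonneg, (ENNReal.ofReal_toReal hν.ne).symm⟩
  obtain ⟨k₀, k₁, k₂, C', hk₀, hk₁, hk₂, -, hmerge⟩ :=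
    exists_wass_lawAt_le (ν := ν) (N := N) hκ hC hC1 hφ₀ hφ₁ hφ₂ le_rfl hS
  obtain ⟨hbox, hmerge⟩ := hmerge θ
  have hinit : ∀ {k₀ k₁ k₂ : ℝ}, 0 ≤ k₀ → 0 ≤ k₁ → 0 ≤ k₂ → ∀ᵐ h ∂(Measure.dirac h₀),
      h.1 ∈ goodData κ ∧ h.2.1 ∈ box d N k₀ k₁ k₂ := fun h0 h1 h2 =>
    (ae_dirac_iff measurableSet_region).2 ⟨hu₀, zero_mem_box h0 h1 h2⟩
  let μs : ℕ → ProbabilityMeasure (State d dZ N) := fun t =>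
    ⟨lawAt (jointKernel κ ν φ θ) (Measure.dirac h₀) t, isProbabilityMeasure_lawAt _ _ t⟩
  have hsucc : ∀ t, (μs (t + 1) : Measure (State d dZ N)) =
      (μs t : Measure (State d dZ N)).bind (jointKernel κ ν φ θ) := fun t => lawAt_succ _ _ t
  have hμs : ∀ {k₀ k₁ k₂ : ℝ}, 0 ≤ k₀ → 0 ≤ k₁ → 0 ≤ k₂ →
      (∀ (u : Data d dZ), ‖u‖ ≤ 1 → ∀ v ∈ box d N k₀ k₁ k₂,
        step φ θ (u, v) ∈ box d N k₀ k₁ k₂) →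
      ∀ t, ∀ᵐ h ∂(μs t : Measure (State d dZ N)),
        h.1 ∈ goodData κ ∧ h.2.1 ∈ box d N k₀ k₁ k₂ := fun h0 h1 h2 hb t =>
    ae_mem_lawAt_jointKernel hb (hinit h0 h1 h2) t
  have hwass : Tendsto (fun t => wass 2 (μs (t + 1) : Measure (State d dZ N)) (μs t)) atTop
      (𝓝 0) := by
    refine tendsto_of_tendsto_of_tendsto_of_le_of_le tendsto_const_nhds
      (tendsto_ofReal_mul_sqrt_pow hq C') (fun _ => zero_le) fun t => ?_
    change wass 2 (lawAt (jointKernel κ ν φ θ) _ (t + 1)) _ ≤ _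
    rw [lawAt_succ']
    have h1 := hμs hk₀ hk₁ hk₂ hbox 1
    have e1 : (μs 1 : Measure (State d dZ N)) =
        (Measure.dirac h₀).bind (jointKernel κ ν φ θ) := by
      rw [hsucc 0]; congr 1; exact lawAt_zero _ _
    rw [e1] at h1
    refine hmerge _ _ (e1 ▸ (μs 1).2) inferInstance h1 (hinit hk₀ hk₁ hk₂) ?_ ?_ t
    · rw [lintegral_noise_bind_jointKernel, hSν]
    · rw [lintegral_dirac' _ (by fun_prop)]
      simp [h₀]
  have htight : IsTightMeasureSet (Set.range fun t => (μs t : Measure (State d dZ N))) := by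
    rw [isTightMeasureSet_iff_exists_isCompact_measure_compl_le]
    intro ε hε
    have hnoise : IsTightMeasureSet ({ν} ∪ {Measure.dirac 0}) :=
      isTightMeasureSet_singleton.union isTightMeasureSet_singleton
    obtain ⟨T, hT, hTε⟩ := isTightMeasureSet_iff_exists_isCompact_measure_compl_le.1 hnoise ε hε
    refine ⟨Metric.closedBall 0 1 ×ˢ (box d N k₀ k₁ k₂ ×ˢ T),
      (isCompact_closedBall 0 1).prod ((isCompact_box k₀ k₁ k₂).prod hT), ?_⟩
    rintro _ ⟨t, rfl⟩
    have hη : (μs t : Measure (State d dZ N)).map (fun h => h.2.2) ∈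
        ({ν} ∪ {Measure.dirac 0} : Set (Measure ℝ)) := by
      rcases t with - | t
      · right
        have e : (μs 0 : Measure (State d dZ N)) = Measure.dirac h₀ := lawAt_zero _ _
        rw [e, Measure.map_dirac' (by fun_prop)]
        rfl
      · left
        rw [hsucc]
        exact map_noise_bind_jointKernel κ ν φ θ _
    refine le_trans ?_ (hTε _ hη)
    rw [Measure.map_apply (by fun_prop) hT.measurableSet.compl]
    refine measure_mono_ae ?_
    filter_upwards [hμs hk₀ hk₁ hk₂ hbox t] with h hh hmem hT'
    exact hmem ⟨by simpa using norm_le_one_of_mem_goodData hh.1, hh.2, hT'⟩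
  obtain ⟨μ, ψ, hψ, hlim, hinv⟩ := exists_invariant_of_tendsto_wass
    (isFeller_jointKernel (ν := ν) (φ := φ) hκ θ) hsucc htight hwass
  refine ⟨μ, inferInstance, hinv, fun k₀ k₁ k₂ h0 h1 h2 hb => ?_⟩
  refine ae_mem_of_tendsto hlim (F := {h | h.2.1 ∈ box d N k₀ k₁ k₂})
    ((isClosed_box k₀ k₁ k₂).preimage (by fun_prop)) fun n => ?_
  exact (hμs h0 h1 h2 hb (ψ n)).mono fun h hh => hh.2

end Invariant

end RNN

theorem mainTheorem2 {d dZ N : ℕ} (hd : 0 < d) (hN : 0 < N)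
    (φ : ℝ → ℝ) (C C₁ C₂ : ℝ) (hC : 0 < C) (hφ : ContDiff ℝ 2 φ)
    (hφ₀ : ∀ y, |φ y| ≤ C) (hφ₁ : ∀ y, |deriv φ y| ≤ C₁) (hφ₂ : ∀ y, |deriv (deriv φ) y| ≤ C₂)
    (κ : Kernel (RNN.Data d dZ) (RNN.Data d dZ)) [IsMarkovKernel κ]
    (Lκ : ℝ) (hLκ : 0 ≤ Lκ)
    (hκ : ∀ u u' : RNN.Data d dZ, u ≠ u' →
      RNN.wass 2 (κ u) (κ u') ≤ ENNReal.ofReal (Lκ * ‖u - u'‖))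
    (ρ₀ : Measure (RNN.Data d dZ)) [IsProbabilityMeasure ρ₀] (hρ₀ : RNN.StaysInUnitBox κ ρ₀)
    (ν : Measure ℝ) [IsProbabilityMeasure ν] (hν : ∫⁻ y, ‖y‖ₑ ^ (2 : ℝ) ∂ν < ∞)
    (hq : Lκ ^ 2 + RNN.constL d N C C₁ C₂ ^ 2 < 1) :
    ∃ μ : RNN.Params d N → Measure (RNN.State d dZ N),
      (∀ θ, IsProbabilityMeasure (μ θ) ∧
        ∫⁻ h, ‖h‖ₑ ^ (2 : ℝ) ∂(μ θ) < ∞ ∧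
        Kernel.Invariant (RNN.jointKernel κ ν φ θ) (μ θ) ∧
        ∀ π : Measure (RNN.State d dZ N), IsProbabilityMeasure π →
          Kernel.Invariant (RNN.jointKernel κ ν φ θ) π → π = μ θ) ∧
      ∀ K : ℝ≥0, ∃ C' : ℝ, 0 < C' ∧
        ∀ (θ : RNN.Params d N) (ρ : Measure (RNN.State d dZ N)), IsProbabilityMeasure ρ →
          RNN.StaysInUnitBox κ (ρ.map (fun h => h.1)) →
          (∀ᵐ h ∂ρ, ‖h.2.1‖ ≤ K) →
          ∫⁻ h, ‖h.2.2‖ₑ ^ (2 : ℝ) ∂ρ ≤ K →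
          (∀ t : ℕ, RNN.wass 2 (RNN.lawAt (RNN.jointKernel κ ν φ θ) ρ t) (μ θ) ≤
            ENNReal.ofReal (C' * Real.sqrt (Lκ ^ 2 + RNN.constL d N C C₁ C₂ ^ 2) ^ t)) ∧
          Tendsto (fun t : ℕ => RNN.wass 2 (RNN.lawAt (RNN.jointKernel κ ν φ θ) ρ t) (μ θ))
            atTop (𝓝 0) := by
  -- The constants enter only through `C ≤ L`.
  have hCL : C ≤ RNN.constL d N C C₁ C₂ := (le_max_right _ _).trans (le_max_right _ _)
  have hCL2 : C ^ 2 ≤ RNN.constL d N C C₁ C₂ ^ 2 := pow_le_pow_left₀ hC.le hCL 2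
  have hq' : Lκ ^ 2 + C ^ 2 < 1 := by linarith
  have hC1 : C < 1 := by nlinarith [sq_nonneg Lκ]
  have hL1 : Lκ < 1 := by nlinarith [sq_nonneg C]
  have hκ' : ∀ u u', RNN.wass 2 (κ u) (κ u') ≤ ENNReal.ofReal (Lκ * ‖u - u'‖) := fun u u' => by
    rcases eq_or_ne u u' with rfl | h
    · exact RNN.wass_self_le _
    · exact hκ u u' h
  obtain ⟨u₀, hu₀⟩ := (RNN.ae_mem_goodData hρ₀).exists
  choose μ hμp hinv hμbox using RNN.exists_invariant_jointKernel (N := N) (φ := φ) hC hq' hφ₀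
    hφ₁ hφ₂ hκ' hν hu₀
  have hgood : ∀ θ, ∀ᵐ h ∂(μ θ), h.1 ∈ RNN.goodData κ := fun θ =>
    RNN.ae_mem_goodData_of_invariant hLκ hL1 hκ' hu₀ (hinv θ)
  have hnoise : ∀ θ, ∫⁻ h, ‖h.2.2‖ₑ ^ (2 : ℝ) ∂(μ θ) = ∫⁻ y, ‖y‖ₑ ^ (2 : ℝ) ∂ν := fun θ => by
    conv_lhs => rw [← (hinv θ).def]
    exact RNN.lintegral_noise_bind_jointKernel θ (μ θ)
  let Sν : ℝ := (∫⁻ y, ‖y‖ₑ ^ (2 : ℝ) ∂ν).toReal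
  have hSν : ∫⁻ y, ‖y‖ₑ ^ (2 : ℝ) ∂ν = ENNReal.ofReal Sν := (ENNReal.ofReal_toReal hν.ne).symm
  have hconv : ∀ K : ℝ≥0, ∃ C' : ℝ, 0 < C' ∧
      ∀ (θ : RNN.Params d N) (ρ : Measure (RNN.State d dZ N)), IsProbabilityMeasure ρ →
        RNN.StaysInUnitBox κ (ρ.map (fun h => h.1)) →
        (∀ᵐ h ∂ρ, ‖h.2.1‖ ≤ K) →
        ∫⁻ h, ‖h.2.2‖ₑ ^ (2 : ℝ) ∂ρ ≤ K →
        (∀ t : ℕ, RNN.wass 2 (RNN.lawAt (RNN.jointKernel κ ν φ θ) ρ t) (μ θ) ≤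
          ENNReal.ofReal (C' * Real.sqrt (Lκ ^ 2 + RNN.constL d N C C₁ C₂ ^ 2) ^ t)) ∧
        Tendsto (fun t : ℕ => RNN.wass 2 (RNN.lawAt (RNN.jointKernel κ ν φ θ) ρ t) (μ θ))
          atTop (𝓝 0) := by
    intro K
    obtain ⟨k₀, k₁, k₂, C', hk₀, hk₁, hk₂, hC', hmerge⟩ :=
      RNN.exists_wass_lawAt_le (ν := ν) (N := N) hκ' hC hC1 hφ₀ hφ₁ hφ₂ K.coe_nonneg
        (le_max_of_le_left K.coe_nonneg : 0 ≤ max (K : ℝ) Sν)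
    refine ⟨C', hC', fun θ ρ hρ hstay hV hη => ?_⟩
    have hwass : ∀ t : ℕ, RNN.wass 2 (RNN.lawAt (RNN.jointKernel κ ν φ θ) ρ t) (μ θ) ≤
        ENNReal.ofReal (C' * Real.sqrt (Lκ ^ 2 + RNN.constL d N C C₁ C₂ ^ 2) ^ t) := fun t => by
      obtain ⟨hbox, hmerge⟩ := hmerge θ
      have h1 := hmerge ρ (μ θ) hρ (hμp θ) ?_ ?_ ?_ ?_ t
      · rw [RNN.lawAt_of_invariant (hinv θ)] at h1
        refine h1.trans (ENNReal.ofReal_le_ofReal ?_)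
        gcongr
      · filter_upwards [ae_of_ae_map measurable_fst.aemeasurable (RNN.ae_mem_goodData hstay), hV]
          with h hu hv
        exact ⟨hu, RNN.mem_box_of_norm_le hk₀ hk₁ hk₂ hv⟩
      · exact (hgood θ).and (hμbox θ k₀ k₁ k₂ (K.coe_nonneg.trans hk₀) (K.coe_nonneg.trans hk₁)
          (K.coe_nonneg.trans hk₂) hbox)
      · refine hη.trans ?_
        rw [← ENNReal.ofReal_coe_nnreal]
        exact ENNReal.ofReal_le_ofReal (le_max_left _ _)
      · rw [hnoise, hSν]
        exact ENNReal.ofReal_le_ofReal (le_max_right _ _)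
    exact ⟨hwass, tendsto_of_tendsto_of_tendsto_of_le_of_le tendsto_const_nhds
      (RNN.tendsto_ofReal_mul_sqrt_pow hq C') (fun _ => zero_le) hwass⟩
  refine ⟨μ, fun θ => ⟨hμp θ, ?_, hinv θ, fun π hπp hπ => ?_⟩, hconv⟩
  · obtain ⟨k₀, k₁, k₂, _, hk₀, hk₁, hk₂, _, hmerge⟩ :=
      RNN.exists_wass_lawAt_le (ν := ν) (N := N) hκ' hC hC1 hφ₀ hφ₁ hφ₂ le_rfl le_rfl
    have hb := hμbox θ k₀ k₁ k₂ hk₀ hk₁ hk₂ (hmerge θ).1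
    let k := max k₀ (max k₁ k₂)
    calc ∫⁻ h, ‖h‖ₑ ^ (2 : ℝ) ∂(μ θ)
        ≤ ∫⁻ h, (ENNReal.ofReal (1 ^ 2 + k ^ 2) + ‖h.2.2‖ₑ ^ (2 : ℝ)) ∂(μ θ) := by
          refine lintegral_mono_ae ?_
          filter_upwards [hgood θ, hb] with h hu hv
          rw [RNN.enorm_rpow_two, RNN.enorm_rpow_two,
            ← ENNReal.ofReal_add (by positivity) (by positivity)]
          refine ENNReal.ofReal_le_ofReal ((RNN.norm_state_sq_le h).trans ?_)
          have hv' : ‖h.2.1‖ ≤ k := max_le_max hv.1 (max_le_max hv.2.1 hv.2.2)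
          gcongr
          exact RNN.norm_le_one_of_mem_goodData hu
      _ = ENNReal.ofReal (1 ^ 2 + k ^ 2) + ∫⁻ y, ‖y‖ₑ ^ (2 : ℝ) ∂ν := by
          rw [lintegral_add_left (by fun_prop), hnoise, lintegral_const, measure_univ, mul_one]
      _ < ∞ := ENNReal.add_lt_top.2 ⟨ENNReal.ofReal_lt_top, hν⟩
  · -- The chain started from any point with good data converges weakly to `μ θ`; averaging over
    -- the starting point shows that an invariant law is `μ θ`.
    have hpoint : ∀ h : RNN.State d dZ N, h.1 ∈ RNN.goodData κ →
        ∀ f : BoundedContinuousFunction (RNN.State d dZ N) ℝ≥0,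
        Tendsto (fun t : ℕ => ∫⁻ h', f h' ∂((RNN.jointKernel κ ν φ θ ^ t) h)) atTop
          (𝓝 (∫⁻ h', f h' ∂(μ θ))) := by
      intro h hh f
      obtain ⟨C', -, hC'⟩ := hconv (max ‖h.2.1‖₊ (‖h.2.2‖₊ ^ 2))
      have hlim := (hC' θ (Measure.dirac h) inferInstance ?_ ?_ ?_).2
      · have := RNN.tendsto_of_tendsto_wass
          (μs := fun t => ⟨RNN.lawAt (RNN.jointKernel κ ν φ θ) (Measure.dirac h) t,
            RNN.isProbabilityMeasure_lawAt _ _ t⟩) (μ := ⟨μ θ, hμp θ⟩) hlim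
        have := ProbabilityMeasure.tendsto_iff_forall_lintegral_tendsto.1 this f
        simp_rw [← RNN.lawAt_dirac]
        exact this
      · rw [Measure.map_dirac' measurable_fst]
        exact RNN.staysInUnitBox_dirac hh
      · rw [ae_dirac_iff (measurableSet_le (by fun_prop) measurable_const)]
        exact le_max_left _ _
      · rw [lintegral_dirac' _ (by fun_prop), ENNReal.rpow_two, enorm_eq_nnnorm]
        exact_mod_cast le_max_right _ _
    refine ext_of_forall_lintegral_eq_of_IsFiniteMeasure fun f => ?_
    have hfm : Measurable fun x => (f x : ℝ≥0∞) := by fun_prop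
    have hconst : ∀ t : ℕ, ∫⁻ h, f h ∂π =
        ∫⁻ h, ∫⁻ h', f h' ∂((RNN.jointKernel κ ν φ θ ^ t) h) ∂π := fun t => by
      conv_lhs => rw [← RNN.lawAt_of_invariant hπ t]
      exact Measure.lintegral_bind (Kernel.aemeasurable _) hfm.aemeasurable
    have hlim : Tendsto (fun t : ℕ => ∫⁻ h, ∫⁻ h', f h' ∂((RNN.jointKernel κ ν φ θ ^ t) h) ∂π)
        atTop (𝓝 (∫⁻ _, ∫⁻ h', f h' ∂(μ θ) ∂π)) := by
      refine tendsto_lintegral_of_dominated_convergence (fun _ => (nndist 0 f : ℝ≥0∞))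
        (fun t => hfm.lintegral_kernel) (fun t => .of_forall fun h => ?_) (by simp) ?_
      · have : IsProbabilityMeasure ((RNN.jointKernel κ ν φ θ ^ t) h) := by
          rw [← RNN.lawAt_dirac]; exact RNN.isProbabilityMeasure_lawAt _ _ t
        simpa using f.lintegral_le_edist_mul ((RNN.jointKernel κ ν φ θ ^ t) h)
      · filter_upwards [RNN.ae_mem_goodData_of_invariant hLκ hL1 hκ' hu₀ hπ] with h hh
        exact hpoint h hh f
    rw [lintegral_const, measure_univ, mul_one] at hlim
    exact tendsto_nhds_unique (tendsto_const_nhds.congr hconst) hlim
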